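/- **Theorem.** Let $k/\mathbb{Q}$ be a finite Galois extension with group $G$ such that $k$ is a CM field, let $c\in G$ be complex conjugation, and let $p$ be a prime number. Let $E_p(k)$ be the group of all $x\in k^*$ with $\|x\|_v=1$ for every place $v\nmid p$ of $k$ (archimedean places included). For an infinite place $v$ with completion $k_v\cong\mathbb{C}$ let $\mathbb{R}(1)_v=\{z\in k_v\mid \mathrm{Re}\,z=0\}$, let $\mathbb{Z}(1)_v\subset\mathbb{R}(1)_v$ be the subgroup corresponding to $2\pi i\mathbb{Z}\subset\mathbb{C}$, and let $$\alpha_{p,\infty}\colon E_p(k)\longrightarrow T_k=\bigoplus_{v\mid\infty}\mathbb{R}(1)_v/\mathbb{Z}(1)_v,\qquad x\longmapsto(\log_v x)_{v\mid\infty},$$ where $\log_v$ is the complex logarithm on the elements of norm one of $k_v$. Let $C=T_k/\overline{\alpha_{p,\infty}(E_p(k))}^{\,0}$, where $^0$ denotes the connected component of zero of the closure. Fix an embedding $k\subset\mathbb{C}$ and for every $v\mid\infty$ choose $\sigma_v\in G$ such that $\sigma_v$ followed by $k\subset\mathbb{C}$ induces $v$; denote also by $\sigma_v$ the induced isomorphism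 $k_v\to\mathbb{C}$. For $\mu\in\bigoplus_{v\mid\infty}\mathbb{Z}$ let $\chi_\mu$ be the character $\chi_\mu(t)=\prod_{v\mid\infty}\exp(\mu_v\,\sigma_v t_v)$ of $T_k$. Let $\mathcal{T}$ be the set of primes $\mathfrak{p}\mid p$ of $k$ with $c\mathfrak{p}\neq\mathfrak{p}$ and let $S\subset\mathcal{T}$ be a system of representatives of $\mathcal{T}$ modulo complex conjugation. For $\mathfrak{p},\mathfrak{p}'\in S$ and $v\mid\infty$ put $\varepsilon_{\mathfrak{p},\mathfrak{p}'}(v)=1$ if $\sigma_v\mathfrak{p}=\mathfrak{p}'$, $\varepsilon_{\mathfrak{p},\mathfrak{p}'}(v)=-1$ if $\sigma_v\mathfrak{p}=c\mathfrak{p}'$, and $\varepsilon_{\mathfrak{p},\mathfrak{p}'}(v)=0$ otherwise. Let $\langle a,b\rangle=\sum_{v\mid\infty}a_vb_v$. Then: 1. The map $\mu\mapsto\chi_\mu$ is a bijection from $\bigoplus_{v\mid\infty}\mathbb{Z}$ onto the Pontryagin dual $\widehat{T}_k$, and under this identification the Pontryagin dual of $C$ is $$\widehat{C}=\Big\{\mu\in\bigoplus_{v\mid\infty}\mathbb{Z}\;\Big|\;\langle\mu,\varepsilon_{\mathfrak{p},\mathfrak{p}'}\rangle=0\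 \text{ for all }\mathfrak{p},\mathfrak{p}'\in S\Big\}.$$ That is, there is an isomorphism of topological groups from the (discrete) group on the right onto $\widehat{C}$ which sends $\mu$ to the character of $C$ whose pullback to $T_k$ is $\chi_\mu$. 2. The dimension of the Lie group $\overline{\alpha_{p,\infty}(E_p(k))}$ is equal to the dimension of the $\mathbb{Q}$-span of the functions $\varepsilon_{\mathfrak{p},\mathfrak{p}'}$, $\mathfrak{p},\mathfrak{p}'\in S$, in $\bigoplus_{v\mid\infty}\mathbb{Q}$. 3. If $p$ is completely decomposed in $k$, then $\alpha_{p,\infty}(E_p(k))$ is dense in $T_k$. -/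

import Mathlib

noncomputable section

open scoped Pointwise
open NumberField

namespace PWeil

section Group

variable (K : Type*) [Field K] [NumberField K]

/-- The group `E_p(k)` of all `x ∈ kˣ` whose absolute value is `1` at every place `v ∤ p`,
the archimedean places included. -/
def weilUnits (p : ℕ) : Subgroup Kˣ where
  carrier := {x | (∀ v : InfinitePlace K, v (x : K) = 1) ∧
    ∀ q : IsDedekindDomain.HeightOneSpectrum (𝓞 K), (p : 𝓞 K) ∉ q.asIdeal →
      q.valuation K (x : K) = 1}
  one_mem' := by simp
  mul_mem' := by
    rintro x y ⟨hx, hx'⟩ ⟨hy, hy'⟩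
    exact ⟨fun v => by simp [hx v, hy v], fun q hq => by simp [hx' q hq, hy' q hq]⟩
  inv_mem' := by
    rintro x ⟨hx, hx'⟩
    exact ⟨fun v => by simp [hx v], fun q hq => by simp [hx' q hq]⟩

end Group

section Local

variable {K : Type*} [Field K]

/-- A complex embedding `φ` of `k` that induces the infinite place `v` is an isometry for `v`. -/
theorem isometry_of_mk_eq (v : InfinitePlace K) (φ : K →+* ℂ) (h : InfinitePlace.mk φ = v) :
    Isometry (φ.comp (WithAbs.equiv v.1).toRingHom) :=
  AddMonoidHomClass.isometry_of_norm _ fun x => by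
    subst h
    rfl

/-- The continuous extension `k_v → ℂ` of a complex embedding `φ` of `k` inducing the place `v`. -/
def extend (v : InfinitePlace K) (φ : K →+* ℂ) (h : InfinitePlace.mk φ = v) :
    v.Completion →+* ℂ :=
  (isometry_of_mk_eq v φ h).extensionHom.comp (InfinitePlace.Completion.equiv v).toRingHom

theorem extend_coe (v : InfinitePlace K) (φ : K →+* ℂ) (h : InfinitePlace.mk φ = v)
    (x : WithAbs v.1) : extend v φ h x = φ (WithAbs.equiv v.1 x) :=
  (isometry_of_mk_eq v φ h).extensionHom_coe _

theorem continuous_extend (v : InfinitePlace K) (φ : K →+* ℂ) (h : InfinitePlace.mk φ = v) :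
    Continuous (extend v φ h) :=
  ((isometry_of_mk_eq v φ h).completion_extension.comp
    (InfinitePlace.Completion.isometry_toCompletion v)).continuous

/-- Two embeddings inducing `v` have extensions to `k_v` which agree up to conjugation. -/
theorem extend_eq_or (v : InfinitePlace K) (φ : K →+* ℂ) (h : InfinitePlace.mk φ = v) :
    (∀ z, extend v φ h z = InfinitePlace.Completion.extensionEmbedding v z) ∨
    (∀ z, extend v φ h z =
      starRingEnd ℂ (InfinitePlace.Completion.extensionEmbedding v z)) := by
  have hc := (InfinitePlace.Completion.isometry_extensionEmbedding v).continuous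
  have h2 : InfinitePlace.mk φ = InfinitePlace.mk v.embedding := by
    rw [InfinitePlace.mk_embedding, h]
  rcases InfinitePlace.mk_eq_iff.mp h2 with h3 | h3
  · left
    intro z
    induction z using InfinitePlace.Completion.induction_on with
    | hp => exact isClosed_eq (continuous_extend v φ h) hc
    | ih a => rw [extend_coe, InfinitePlace.Completion.extensionEmbedding_coe, h3]
  · right
    intro z
    induction z using InfinitePlace.Completion.induction_on with
    | hp => exact isClosed_eq (continuous_extend v φ h) (Complex.continuous_conj.comp hc)
    | ih a =>
      rw [extend_coe, InfinitePlace.Completion.extensionEmbedding_coe, ← h3]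
      simp [ComplexEmbedding.conjugate_coe_eq]

/-- `ℝ(1)_v`, the elements of `k_v` with real part `0`. -/
def R1 (v : InfinitePlace K) : AddSubgroup v.Completion where
  carrier := {z | (InfinitePlace.Completion.extensionEmbedding v z).re = 0}
  zero_mem' := by simp
  add_mem' := by
    intro a b ha hb
    simp only [Set.mem_ofPred_eq] at ha hb
    simp [ha, hb]
  neg_mem' := by
    intro a ha
    simp only [Set.mem_ofPred_eq] at ha
    simp [ha]

/-- `ℤ(1)_v`, the elements of `k_v` corresponding to `2πiℤ ⊆ ℂ`, as a subgroup of `ℝ(1)_v`. -/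
def Z1 (v : InfinitePlace K) : AddSubgroup (R1 v) where
  carrier := {z | ∃ n : ℤ, InfinitePlace.Completion.extensionEmbedding v (z : v.Completion) =
    n * (2 * Real.pi * Complex.I)}
  zero_mem' := ⟨0, by simp⟩
  add_mem' := by
    rintro a b ⟨m, hm⟩ ⟨n, hn⟩
    exact ⟨m + n, by push_cast; rw [map_add, hm, hn]; ring⟩
  neg_mem' := by
    rintro a ⟨m, hm⟩
    exact ⟨-m, by push_cast; rw [map_neg, hm]; ring⟩

/-- The torus `T_k = ⨁_{v ∣ ∞} ℝ(1)_v / ℤ(1)_v`. -/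
abbrev Torus (K : Type*) [Field K] : Type _ := ∀ v : InfinitePlace K, R1 v ⧸ Z1 v

/-- For a complex place `v`, the representative in `ℝ(1)_v` of the logarithm of an element of `k_v`
of norm one which corresponds to the principal branch under `k_v ≅ ℂ`. -/
def logRep (v : InfinitePlace K) (hv : v.IsComplex) (x : Metric.sphere (0 : v.Completion) 1) :
    R1 v :=
  ⟨(InfinitePlace.Completion.ringEquivComplexOfIsComplex hv).symm
      (Complex.log (InfinitePlace.Completion.extensionEmbedding v x)), by
    change (InfinitePlace.Completion.extensionEmbedding v _).re = 0
    rw [← InfinitePlace.Completion.ringEquivComplexOfIsComplex_apply hv, RingEquiv.apply_symm_apply,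
      Complex.log_re, (AddMonoidHomClass.isometry_iff_norm _).mp
        (InfinitePlace.Completion.isometry_extensionEmbedding v)]
    simp⟩

theorem extensionEmbedding_logRep (v : InfinitePlace K) (hv : v.IsComplex)
    (x : Metric.sphere (0 : v.Completion) 1) :
    InfinitePlace.Completion.extensionEmbedding v (logRep v hv x : v.Completion) =
      Complex.log (InfinitePlace.Completion.extensionEmbedding v x) := by
  rw [← InfinitePlace.Completion.ringEquivComplexOfIsComplex_apply hv]
  simp [logRep]

/-- The logarithm `log_v : k_{v,1}ˣ → ℝ(1)_v / ℤ(1)_v` at a complex place `v`, where `k_{v,1}ˣ` is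
the group of elements of norm one. -/
def logAt (v : InfinitePlace K) (hv : v.IsComplex) :
    Additive (Metric.sphere (0 : v.Completion) 1) →+ R1 v ⧸ Z1 v :=
  AddMonoidHom.mk' (fun x => QuotientAddGroup.mk (logRep v hv x.toMul)) (by
    intro a b
    rw [← QuotientAddGroup.mk_add, QuotientAddGroup.eq]
    set x := a.toMul
    set y := b.toMul
    have ne (z : Metric.sphere (0 : v.Completion) 1) :
        InfinitePlace.Completion.extensionEmbedding v z ≠ 0 := by
      rw [map_ne_zero]
      exact ne_zero_of_mem_unit_sphere z
    have key : Complex.exp (InfinitePlace.Completion.extensionEmbedding v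
        ((-logRep v hv (x * y) + (logRep v hv x + logRep v hv y) : R1 v) :
          v.Completion)) = 1 := by
      rw [AddSubgroup.coe_add, AddSubgroup.coe_neg, AddSubgroup.coe_add,
        map_add, map_neg, map_add, extensionEmbedding_logRep, extensionEmbedding_logRep,
        extensionEmbedding_logRep, Complex.exp_add, Complex.exp_neg, Complex.exp_add,
        Complex.exp_log (ne _), Complex.exp_log (ne _), Complex.exp_log (ne _)]
      have hxy : ((x * y : Metric.sphere (0 : v.Completion) 1) : v.Completion) = x * y := rfl
      rw [hxy, map_mul]
      exact inv_mul_cancel₀ (mul_ne_zero (ne x) (ne y))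
    obtain ⟨n, hn⟩ := Complex.exp_eq_one_iff.mp key
    exact ⟨n, hn⟩)

/-- For an embedding `φ` inducing `v`, the character `z ↦ exp (φ z)` of `ℝ(1)_v / ℤ(1)_v`. -/
def expAt (v : InfinitePlace K) (φ : K →+* ℂ) (h : InfinitePlace.mk φ = v) :
    R1 v ⧸ Z1 v →+ Additive Circle :=
  QuotientAddGroup.lift (Z1 v)
    (AddMonoidHom.mk' (fun z => Additive.ofMul (Circle.exp (extend v φ h (z : v.Completion)).im))
      (by intro a b; simp [Circle.exp_add]))
    (by
      rintro z ⟨n, hn⟩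
      change Circle.exp (extend v φ h (z : v.Completion)).im = 1
      rcases extend_eq_or v φ h with h1 | h1
      · rw [h1, hn, Circle.exp_eq_one]
        exact ⟨n, by simp⟩
      · rw [h1, hn, Circle.exp_eq_one]
        exact ⟨-n, by simp⟩)

/-- The character above is `z ↦ exp (φ z)` as a complex number. -/
theorem coe_expAt (v : InfinitePlace K) (φ : K →+* ℂ) (h : InfinitePlace.mk φ = v) (z : R1 v) :
    (((expAt v φ h (QuotientAddGroup.mk z)).toMul : Circle) : ℂ) =
      Complex.exp (extend v φ h (z : v.Completion)) := by
  change ((Circle.exp (extend v φ h (z : v.Completion)).im : Circle) : ℂ) = _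
  have hz : (InfinitePlace.Completion.extensionEmbedding v (z : v.Completion)).re = 0 := z.2
  have hre : (extend v φ h (z : v.Completion)).re = 0 := by
    rcases extend_eq_or v φ h with h1 | h1 <;> simp [h1, hz]
  rw [Circle.coe_exp]
  congr 1
  apply Complex.ext <;> simp [hre]

theorem continuous_expAt (v : InfinitePlace K) (φ : K →+* ℂ) (h : InfinitePlace.mk φ = v) :
    Continuous (fun t => (expAt v φ h t).toMul) := by
  refine (QuotientAddGroup.isQuotientMap_mk (Z1 v)).continuous_iff.mpr ?_
  change Continuous fun z : R1 v => Circle.exp (extend v φ h (z : v.Completion)).im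
  exact Circle.exp.continuous.comp
    (Complex.continuous_im.comp ((continuous_extend v φ h).comp continuous_subtype_val))

end Local

section Dimension

/-- The one-parameter subgroups of an abelian topological group `A`. -/
def OneParam (A : Type*) [AddCommGroup A] [TopologicalSpace A] : Type _ := ℝ →ₜ+ A

variable (A : Type*) [AddCommGroup A] [TopologicalSpace A] [IsTopologicalAddGroup A]

instance : AddCommGroup (OneParam A) := inferInstanceAs (AddCommGroup (ℝ →ₜ+ A))

/-- The real structure `(s • γ)(t) = γ(st)` on one-parameter subgroups. -/
instance : Module ℝ (OneParam A) where
  smul s γ := ContinuousAddMonoidHom.comp (γ : ℝ →ₜ+ A)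
    ⟨AddMonoidHom.mulLeft s, continuous_const_mul s⟩
  one_smul γ := ContinuousAddMonoidHom.ext fun t => congrArg (show ℝ →ₜ+ A from γ) (one_mul t)
  mul_smul r s γ := ContinuousAddMonoidHom.ext fun t =>
    congrArg (show ℝ →ₜ+ A from γ) (by change r * s * t = s * (r * t); ring)
  smul_zero _ := rfl
  smul_add _ _ _ := rfl
  add_smul r s γ := ContinuousAddMonoidHom.ext fun t =>
    (congrArg (show ℝ →ₜ+ A from γ) (add_mul r s t)).trans (map_add (show ℝ →ₜ+ A from γ) _ _)
  zero_smul γ := ContinuousAddMonoidHom.ext fun t =>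
    (congrArg (show ℝ →ₜ+ A from γ) (zero_mul t)).trans (map_zero (show ℝ →ₜ+ A from γ))

/-- The dimension of an abelian Lie group: the dimension of its Lie algebra, the real vector space
of its one-parameter subgroups. -/
def lieDim : Cardinal := Module.rank ℝ (OneParam A)

end Dimension

section Global

variable (K : Type*) [Field K] [NumberField K]

/-- The diagonal map from `E_p(k)` to the elements of norm one of `k_v`. -/
def diag (p : ℕ) (v : InfinitePlace K) :
    weilUnits K p →* Metric.sphere (0 : v.Completion) 1 where
  toFun x := ⟨(((WithAbs.equiv v.1).symm ((x : Kˣ) : K) : WithAbs v.1) : v.Completion), by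
    rw [mem_sphere_zero_iff_norm, InfinitePlace.Completion.norm_coe]
    simpa using x.2.1 v⟩
  map_one' := by ext; simp
  map_mul' x y := by
    refine Subtype.ext ?_
    change _ = (_ : v.Completion) * _
    rw [← InfinitePlace.Completion.coe_mul]
    simp

/-- The map `α_{p,∞} : E_p(k) → T_k`, the diagonal map followed by the logarithms. -/
def alpha [IsTotallyComplex K] (p : ℕ) : Additive (weilUnits K p) →+ Torus K :=
  AddMonoidHom.mk' (fun x v => logAt v (IsTotallyComplex.isComplex v)
    (Additive.ofMul (diag K p v x.toMul))) (by
      intro x y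
      funext v
      simp only [toMul_add, map_mul, ofMul_mul, map_add, Pi.add_apply])

/-- The closure of `α_{p,∞}(E_p(k))` in `T_k`. -/
def imageClosure [IsTotallyComplex K] (p : ℕ) : AddSubgroup (Torus K) :=
  (alpha K p).range.topologicalClosure

/-- The connected component of zero of the closure of the image, as a subgroup of `T_k`. -/
def imageClosureZero [IsTotallyComplex K] (p : ℕ) : AddSubgroup (Torus K) :=
  (AddSubgroup.connectedComponentOfZero (imageClosure K p)).map (imageClosure K p).subtype

/-- The quotient `C` of `T_k` by the connected component of zero of the closure of the image. -/
abbrev QuotC [IsTotallyComplex K] (p : ℕ) : Type _ := Torus K ⧸ imageClosureZero K p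

variable {K}

/-- The character `χ_μ(t) = ∏_v exp (μ_v σ_v t_v)` of `T_k`, for embeddings `σ_v` of `k` inducing
the infinite places `v`. -/
def chi (σ : InfinitePlace K → (K →+* ℂ)) (hσ : ∀ v, InfinitePlace.mk (σ v) = v)
    (μ : InfinitePlace K → ℤ) : PontryaginDual (Multiplicative (Torus K)) :=
  (⟨MonoidHom.mk' (fun t => ∏ v, ((expAt v (σ v) (hσ v) (t.toAdd v)).toMul) ^ μ v) (by
      intro s t
      rw [← Finset.prod_mul_distrib]
      refine Finset.prod_congr rfl fun v _ => ?_
      rw [toAdd_mul, Pi.add_apply, map_add, toMul_add, mul_zpow]), by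
    refine continuous_finsetProd _ fun v _ => ?_
    exact ((continuous_expAt v (σ v) (hσ v)).comp
      ((continuous_apply v).comp continuous_toAdd)).zpow (μ v)⟩ :
    Multiplicative (Torus K) →ₜ* Circle)

variable (K)

/-- Complex conjugation of a CM field as an automorphism over `ℚ`. -/
def conj [IsCMField K] : Gal(K/ℚ) := (IsCMField.complexConj K).restrictScalars ℚ

/-- The primes of `k` above `p` that are not fixed by complex conjugation. -/
def primesT [IsCMField K] (p : ℕ) : Set (Ideal (𝓞 K)) :=
  {P | P ∈ (Ideal.span {(p : ℤ)}).primesOver (𝓞 K) ∧ conj K • P ≠ P}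

/-- `S` is a system of representatives of `𝒯` modulo complex conjugation. -/
def IsRepSystem [IsCMField K] (p : ℕ) (S : Set (Ideal (𝓞 K))) : Prop :=
  S ⊆ primesT K p ∧ ∀ P ∈ primesT K p, ∃! Q, Q ∈ S ∧ (Q = P ∨ Q = conj K • P)

/-- `p` is completely decomposed in `k`: there are `[k : ℚ]` primes above it. -/
def SplitsCompletely (p : ℕ) : Prop :=
  ((Ideal.span {(p : ℤ)}).primesOver (𝓞 K)).ncard = Module.finrank ℚ K

variable {K}

open scoped Classical in
/-- The function `ε_{P,P'}` on the infinite places: `1` if `σ_v P = P'`, `-1` if `σ_v P = c P'`,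
and `0` otherwise. -/
def eps [IsCMField K] (σ : InfinitePlace K → Gal(K/ℚ)) (P P' : Ideal (𝓞 K))
    (v : InfinitePlace K) : ℤ :=
  if σ v • P = P' then 1 else if σ v • P = conj K • P' then -1 else 0

/-- The `μ ∈ ⨁_{v ∣ ∞} ℤ` orthogonal to all `ε_{P,P'}` with `P, P' ∈ S`. -/
def orthEps [IsCMField K] (σ : InfinitePlace K → Gal(K/ℚ)) (S : Set (Ideal (𝓞 K))) :
    AddSubgroup (InfinitePlace K → ℤ) where
  carrier := {μ | ∀ P ∈ S, ∀ P' ∈ S, ∑ v, μ v * eps σ P P' v = 0}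
  zero_mem' := by simp
  add_mem' := by
    intro a b ha hb P hP P' hP'
    simp [add_mul, Finset.sum_add_distrib, ha P hP P' hP', hb P hP P' hP']
  neg_mem' := by
    intro a ha P hP P' hP'
    simp [ha P hP P' hP']

/-- The `ℚ`-span of the `ε_{P,P'}` with `P, P' ∈ S` in `⨁_{v ∣ ∞} ℚ`. -/
def spanEps [IsCMField K] (σ : InfinitePlace K → Gal(K/ℚ)) (S : Set (Ideal (𝓞 K))) :
    Submodule ℚ (InfinitePlace K → ℚ) :=
  Submodule.span ℚ {f | ∃ P ∈ S, ∃ P' ∈ S, f = fun v => (eps σ P P' v : ℚ)}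

end Global

end PWeil

end

/-!
Write `φ_v = ι ∘ σ_v`. The characters `exp (φ_v t_v)` identify the torus `T_k` with a product of
circles (`torusHomeo`), and with this `χ_μ` becomes the monomial of exponent `μ`. The first claim
holds because a continuous homomorphism `ℝ → Circle` is `t ↦ exp (i a t)`: a character of `T_k` is
determined by its restrictions to the coordinate lines, where its exponents have to be integers.

Let `H` be the closure of the image of `E_p(k)`. The argument compares the lattice `H^⊥` of all `μ`
with `χ_μ = 1` on `H` to the lattice `M` of all `μ` orthogonal to the `ε_{P,P'}`. As
`χ_μ (α x) = ι (∏_v σ_v(x)^{μ_v})`, membership in `H^⊥` is a condition on the elements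
`∏_v σ_v(x)^{μ_v}` of `E_p(k)`, and it is studied through their orders at the primes over `p`.

* Every `x ∈ E_p(k)` satisfies `x · c x = 1`, so its order vanishes at the primes fixed by `c` and
  changes sign under `P ↦ c P` (`ord_conj_smul`). Hence the order of `∏_v σ_v(x)^{μ_v}` at `P' ∈ S`
  is `∑_{P ∈ S} ⟨μ, ε_{P,P'}⟩ ord_P(x)`. If `μ ∈ M`, then all orders of `∏_v σ_v(x)^{μ_v}` are
  zero, and by Kronecker's theorem it is a root of unity; so `w M ⊆ H^⊥`, with `w` the
  number of roots of unity in `k` (`galProd_pow_torsionOrder_eq_one`).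
* For `P ∈ 𝒯` let `y` generate a power of `P`. Then `y / c y` lies in `E_p(k)`, and its order is
  nonzero only at `P` and `c P`. This gives `H^⊥ ⊆ M` (`sum_mul_eps_eq_zero_of_galProd_eq_one`).

The analytic input is the duality `H = (H^⊥)^⊥` for closed subgroups of a product of circles
(`mem_of_forall_monomial`). It shows that the line `t ↦ t a` of `T_k` lies in `H` if and only if `a`
is orthogonal to `M` (`forall_lineMap_mem_iff`); in particular the lines of the `ε_{P,P'}` lie in
the connected component `H⁰`.

* A character `χ_μ` that is trivial on `H⁰` is trivial on these lines, so `μ ∈ M`. Conversely, if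
  `μ ∈ M`, then `χ_μ` takes values in the `w`-th roots of unity on `H`, so it is constant on the
  connected set `H⁰`. This is the description of the dual of `C`.
* The Lie algebra of `H` is the real space orthogonal to `M`. Since `M` consists of the integral
  vectors orthogonal to the rational space spanned by the `ε_{P,P'}`, the two dimensions agree
  (`rank_eq_rank_of_forall_mem_iff`).
* If `p` is completely decomposed, then `G` acts simply transitively on the primes over `p`. So each
  `v` is the only place in the support of some `ε_{P,P'}`, and `M = 0`, whence `H = T_k`.
-/

noncomputable section

open scoped Pointwise
open NumberField

namespace PWeil

/-! ### Characters of the real line and of products of circles -/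

/-- A continuous homomorphism from `ℝ` to the circle lifts through the covering `Circle.exp` to a
continuous, hence linear, endomorphism of `ℝ`. -/
theorem exists_eq_circle_exp (f : ℝ → Circle) (hf : Continuous f)
    (hadd : ∀ s t, f (s + t) = f s * f t) : ∃ a : ℝ, ∀ t, f t = Circle.exp (a * t) := by
  have h0 : f 0 = 1 := by
    have := hadd 0 0
    rw [add_zero] at this
    exact left_eq_mul.mp this
  obtain ⟨F, ⟨hF0, hF⟩, -⟩ := Circle.isCoveringMap_exp.existsUnique_continuousMap_lifts
    ⟨f, hf⟩ 0 0 (by simp [h0])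
  have hF' (t : ℝ) : Circle.exp (F t) = f t := congrFun hF t
  have key (s t : ℝ) : F (s + t) = F s + F t := by
    -- both sides are lifts, continuous in `t`, which agree at `t = 0`
    have := Circle.isCoveringMap_exp.eq_of_comp_eq (g₁ := fun t => F (s + t))
      (g₂ := fun t => F s + F t) (by fun_prop) (by fun_prop) (by
        funext u
        simp [Circle.exp_add, hF', hadd]) 0 (by simp [hF0])
    exact congrFun this t
  let L : ℝ →L[ℝ] ℝ := (AddMonoidHom.mk' F key).toRealLinearMap F.continuous
  refine ⟨F 1, fun t => ?_⟩
  rw [← hF' t]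
  congr 1
  have : L (t • 1) = t • L 1 := L.map_smul t 1
  rw [smul_eq_mul, mul_one, smul_eq_mul, mul_comm] at this
  exact this

/-- A one-parameter subgroup `t ↦ exp (i t a)` of the circle determines `a`. -/
theorem eq_of_circle_exp_mul {a b : ℝ} (h : ∀ t : ℝ, Circle.exp (t * a) = Circle.exp (t * b)) :
    a = b := by
  by_contra hab
  have hab' : a - b ≠ 0 := sub_ne_zero.mpr hab
  -- at `t = π / (a - b)` the quotient of the two sides is `-1`
  obtain ⟨m, hm⟩ := Circle.exp_eq_exp.mp (h (Real.pi / (a - b)))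
  have h1 : Real.pi * 1 = Real.pi * (2 * m) := by
    have : Real.pi / (a - b) * a - Real.pi / (a - b) * b = Real.pi := by
      rw [← mul_sub, div_mul_cancel₀ _ hab']
    linarith
  have h2 : (1 : ℤ) = 2 * m := by exact_mod_cast mul_left_cancel₀ Real.pi_ne_zero h1
  omega

section Duality
open MeasureTheory

variable {n : Type*} [Fintype n]

/-- The character `z ↦ ∏ v, z v ^ μ v` of a finite product of circles. -/
def monomial (μ : n → ℤ) : (n → Circle) →* Circle where
  toFun z := ∏ v, z v ^ μ v
  map_one' := by simp
  map_mul' x y := by simp [mul_zpow, Finset.prod_mul_distrib]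

theorem monomial_apply (μ : n → ℤ) (z : n → Circle) : monomial μ z = ∏ v, z v ^ μ v := rfl

theorem coe_monomial (μ : n → ℤ) (z : n → Circle) :
    (monomial μ z : ℂ) = ∏ v, (z v : ℂ) ^ μ v :=
  (map_prod Circle.coeHom (fun v => z v ^ μ v) Finset.univ).trans
    (Finset.prod_congr rfl fun v _ => Circle.coe_zpow (z v) (μ v))

theorem continuous_monomial (μ : n → ℤ) : Continuous (monomial μ : (n → Circle) → Circle) :=
  continuous_finsetProd _ fun v _ => (continuous_apply v).zpow (μ v)

theorem monomial_add (μ ν : n → ℤ) (z : n → Circle) :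
    monomial (μ + ν) z = monomial μ z * monomial ν z := by
  simp [monomial_apply, zpow_add, Finset.prod_mul_distrib]

theorem monomial_neg (μ : n → ℤ) (z : n → Circle) :
    monomial (-μ) z = (monomial μ z)⁻¹ := by
  simp [monomial_apply]

theorem monomial_zero (z : n → Circle) : monomial (0 : n → ℤ) z = 1 := by
  simp [monomial_apply]

theorem monomial_single [DecidableEq n] (v : n) (z : n → Circle) :
    monomial (Pi.single v 1) z = z v := by
  rw [monomial_apply, Finset.prod_eq_single v]
  · simp
  · intro w _ hw
    simp [Pi.single_eq_of_ne hw]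
  · simp

theorem monomial_exp (μ : n → ℤ) (a : n → ℝ) :
    monomial μ (fun v => Circle.exp (a v)) = Circle.exp (∑ v, μ v * a v) := by
  classical
  rw [monomial_apply]
  have (s : Finset n) : Circle.exp (∑ v ∈ s, μ v * a v) = ∏ v ∈ s, Circle.exp (a v) ^ μ v := by
    induction s using Finset.induction_on with
    | empty => simp
    | insert v s hv ih => rw [Finset.sum_insert hv, Finset.prod_insert hv, Circle.exp_add, ih,
        ← Circle.exp_zsmul, zsmul_eq_mul]
  rw [this]

/-- The monomial of exponent `μ` as a continuous complex-valued function. -/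
def monomialC (μ : n → ℤ) : C(n → Circle, ℂ) :=
  ⟨fun z => monomial μ z, continuous_subtype_val.comp (continuous_monomial μ)⟩

variable (n) in
/-- The trigonometric polynomials on a finite product of circles, as the star subalgebra generated
by the monomials. -/
def trigPoly : StarSubalgebra ℂ C(n → Circle, ℂ) where
  toSubalgebra := Algebra.adjoin ℂ (Set.range (monomialC (n := n)))
  star_mem' := by
    change Algebra.adjoin ℂ _ ≤ star (Algebra.adjoin ℂ _)
    refine Algebra.adjoin_le ?_
    rintro - ⟨μ, rfl⟩
    refine Algebra.subset_adjoin ⟨-μ, ?_⟩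
    ext z
    change ((monomial (-μ) z : Circle) : ℂ) = starRingEnd ℂ (monomial μ z : Circle)
    rw [monomial_neg, Circle.coe_inv_eq_conj]

theorem trigPoly_toSubmodule :
    Subalgebra.toSubmodule (trigPoly n).toSubalgebra =
      Submodule.span ℂ (Set.range (monomialC (n := n))) := by
  refine Algebra.adjoin_eq_span_of_subset (R := ℂ) ?_
  refine Set.Subset.trans ?_ Submodule.subset_span
  intro x hx
  induction hx using Submonoid.closure_induction with
  | mem x hx => exact hx
  | one => exact ⟨0, by ext; simp [monomialC, monomial_zero]⟩
  | mul x y _ _ hx hy =>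
    obtain ⟨μ, rfl⟩ := hx
    obtain ⟨ν, rfl⟩ := hy
    exact ⟨μ + ν, by ext; simp [monomialC, monomial_add]⟩

/-- The trigonometric polynomials are dense, by the Stone–Weierstrass theorem. -/
theorem topologicalClosure_span_monomialC :
    (Submodule.span ℂ (Set.range (monomialC (n := n)))).topologicalClosure = ⊤ := by
  classical
  have h : (trigPoly n).topologicalClosure = ⊤ := by
    refine ContinuousMap.starSubalgebra_topologicalClosure_eq_top_of_separatesPoints _ ?_
    intro x y hxy
    obtain ⟨v, hv⟩ := Function.ne_iff.mp hxy
    refine ⟨_, ⟨monomialC (Pi.single v 1), Algebra.subset_adjoin ⟨_, rfl⟩, rfl⟩, ?_⟩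
    simpa [monomialC, monomial_single, Circle.ext_iff] using hv
  rw [← trigPoly_toSubmodule]
  rw [eq_top_iff]
  intro f _
  have : f ∈ (trigPoly n).topologicalClosure := by rw [h]; trivial
  exact this

/-- Duality for closed subgroups of a product of circles: `H` is the common kernel of the monomials
that are trivial on it. If all of these are trivial at `x`, then a monomial has the same mean over
`H` and over `x H`: the two means are equal if it is trivial on `H`, and both are zero otherwise. By
density every continuous function has this property, and Urysohn's lemma gives one without it if the
two cosets are disjoint. -/
theorem mem_of_forall_monomial (H : Subgroup (n → Circle)) (hH : IsClosed (H : Set (n → Circle)))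
    (x : n → Circle)
    (hx : ∀ μ : n → ℤ, (∀ h ∈ H, monomial μ h = 1) → monomial μ x = 1) : x ∈ H := by
  by_contra hxH
  have : CompactSpace H := isCompact_iff_compactSpace.mp hH.isCompact
  let _ : MeasurableSpace H := borel H
  have : BorelSpace H := ⟨rfl⟩
  let m : Measure H := Measure.haarMeasure ⊤
  have : IsProbabilityMeasure m :=
    ⟨by simpa [m] using Measure.haarMeasure_self (K₀ := (⊤ : TopologicalSpace.PositiveCompacts H))⟩
  have hint (f : C(n → Circle, ℂ)) (y : n → Circle) :
      Integrable (fun h : H => f (y * h)) m :=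
    Continuous.integrable_of_hasCompactSupport (by fun_prop) (HasCompactSupport.of_compactSpace _)
  -- the mean over the coset `y H`
  let I (y : n → Circle) : C(n → Circle, ℂ) →L[ℂ] ℂ :=
    LinearMap.mkContinuous
      { toFun := fun f => ∫ h : H, f (y * h) ∂m
        map_add' := fun f g => integral_add (hint f y) (hint g y)
        map_smul' := fun c f => integral_smul c _ } 1 (fun f => by
          have := norm_integral_le_of_norm_le_const (μ := m) (f := fun h : H => f (y * h))
            (C := ‖f‖) (Filter.Eventually.of_forall fun h => f.norm_coe_le_norm _)
          simpa using this)
  have hI (y f) : I y f = ∫ h : H, f (y * h) ∂m := rfl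
  have hV : LinearMap.ker (I x - I 1).toLinearMap = ⊤ := by
    rw [eq_top_iff, ← topologicalClosure_span_monomialC]
    refine Submodule.topologicalClosure_minimal _ (Submodule.span_le.mpr ?_)
      (ContinuousLinearMap.isClosed_ker (I x - I 1))
    rintro - ⟨μ, rfl⟩
    have e (y : n → Circle) : I y (monomialC μ) =
        monomial μ y * ∫ h : H, (monomial μ (h : n → Circle) : ℂ) ∂m := by
      rw [hI, ← integral_const_mul]
      simp [monomialC]
    change I x _ - I 1 _ = 0
    rw [e, e]
    by_cases hμ : ∀ h ∈ H, monomial μ h = 1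
    · rw [hx μ hμ, map_one, sub_self]
    · push Not at hμ
      obtain ⟨h₀, hh₀, hne⟩ := hμ
      have := integral_mul_left_eq_self (μ := m)
        (fun h : H => (monomial μ (h : n → Circle) : ℂ)) ⟨h₀, hh₀⟩
      simp only [Subgroup.coe_mul, map_mul, Circle.coe_mul] at this
      rw [integral_const_mul] at this
      have h0 : ∫ h : H, (monomial μ (h : n → Circle) : ℂ) ∂m = 0 := by
        by_contra h0
        exact hne (Circle.ext (by simpa using (mul_eq_right₀ h0).mp this))
      rw [h0, mul_zero, mul_zero, sub_self]
  obtain ⟨f, hf0, hf1, -⟩ := exists_continuous_zero_one_of_isClosed hH (hH.leftCoset x) (by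
    rw [Set.disjoint_left]
    rintro y hy ⟨h, hh, rfl⟩
    exact hxH ((H.mul_mem_cancel_right hh).mp hy))
  let g : C(n → Circle, ℂ) := ⟨fun z => (f z : ℂ), by fun_prop⟩
  have hg : I x g - I 1 g = 0 := by
    have : g ∈ LinearMap.ker (I x - I 1).toLinearMap := by rw [hV]; trivial
    exact this
  have h1 : I x g = 1 := by
    have (h : H) : g (x * h) = 1 := by
      simpa [g] using hf1 ⟨h, h.2, rfl⟩
    simp [hI, this]
  have h2 : I 1 g = 0 := by
    have (h : H) : g (1 * h) = 0 := by
      simpa [g] using hf0 h.2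
    simp only [hI, this, integral_zero]
  rw [h1, h2] at hg
  simp at hg
end Duality

/-! ### Orthogonal complements over the rational and the real numbers -/

/-- If `V` is the real space orthogonal to all integral vectors that are orthogonal to the rational
space `W`, then `V` and `W` have the same dimension: the matrix of a projection onto `W` is over `ℝ`
the matrix of a projection onto `V`, and the trace of a projection is its rank. -/
theorem rank_eq_rank_of_forall_mem_iff {n : Type*} [Fintype n] (W : Submodule ℚ (n → ℚ))
    (V : Submodule ℝ (n → ℝ))
    (hV : ∀ a, a ∈ V ↔ ∀ μ : n → ℤ, (∀ w ∈ W, ∑ v, (μ v : ℚ) * w v = 0) →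
      ∑ v, (μ v : ℝ) * a v = 0) :
    Module.rank ℝ V = Module.rank ℚ W := by
  classical
  obtain ⟨P, hP⟩ : ∃ P : (n → ℚ) →ₗ[ℚ] (n → ℚ), LinearMap.IsProj W P := by
    obtain ⟨f, hf⟩ := W.subtype.exists_leftInverse_of_injective W.ker_subtype
    exact ⟨W.subtype ∘ₗ f, fun a => (f a).2,
      fun w hw => congrArg Subtype.val (LinearMap.congr_fun hf ⟨w, hw⟩)⟩
  -- the matrix of a projection onto `W`; over `ℝ` it is a projection onto `V`
  let M : Matrix n n ℚ := LinearMap.toMatrix' P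
  have hM (a) : M.mulVec a = P a := by simp [M]
  let Q : (n → ℝ) →ₗ[ℝ] (n → ℝ) := Matrix.toLin' (M.map (algebraMap ℚ ℝ))
  have hQ (a i) : Q a i = ∑ j, (M i j : ℝ) * a j := by
    simp [Q, Matrix.mulVec, dotProduct]
  have hproj : LinearMap.IsProj V Q := by
    constructor
    · intro a
      rw [hV]
      intro μ hμ
      have h0 (j : n) : ∑ i, (μ i : ℝ) * M i j = 0 := by
        have := hμ (P (Pi.single j 1)) (hP.map_mem _)
        rw [← hM] at this
        simp only [Matrix.mulVec_single_one, Matrix.col_apply] at this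
        exact_mod_cast congrArg (fun q : ℚ => (q : ℝ)) this
      simp_rw [hQ, Finset.mul_sum, ← mul_assoc]
      rw [Finset.sum_comm]
      simp_rw [← Finset.sum_mul, h0, zero_mul, Finset.sum_const_zero]
    · intro a ha
      ext i
      -- a common denominator `b` of row `i` of `1 - M` makes this row an integral vector `μ`
      obtain ⟨b, hb⟩ := IsLocalization.exist_integer_multiples_of_finite
        (nonZeroDivisors ℤ) (fun j => (1 - M) i j)
      choose μ hμ using hb
      have hb0 : ((b : ℤ) : ℝ) ≠ 0 := by exact_mod_cast nonZeroDivisors.coe_ne_zero b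
      have hμ' (j) : (μ j : ℚ) = (b : ℤ) * (1 - M) i j := by
        simpa using hμ j
      have h0 := (hV a).mp ha μ (fun w hw => by
        have : P w = w := hP.map_id w hw
        have h1 : ((1 - M).mulVec w) i = 0 := by
          rw [Matrix.sub_mulVec, hM, this]
          simp
        simp_rw [hμ', mul_assoc, ← Finset.mul_sum]
        rw [Matrix.mulVec, dotProduct] at h1
        rw [h1, mul_zero])
      have hμ'' (j) : (μ j : ℝ) = (b : ℤ) * (((1 - M) i j : ℚ) : ℝ) := by
        exact_mod_cast congrArg (fun q : ℚ => (q : ℝ)) (hμ' j)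
      simp_rw [hμ'', mul_assoc, ← Finset.mul_sum] at h0
      have h1 := (mul_eq_zero.mp h0).resolve_left hb0
      simp only [Matrix.sub_apply, Rat.cast_sub, sub_mul, Finset.sum_sub_distrib, ← hQ] at h1
      rw [← sub_eq_zero, ← neg_eq_zero, neg_sub, ← h1]
      congr 1
      rw [Finset.sum_eq_single i] <;> simp +contextual [eq_comm]
  have t1 := hproj.trace
  have t2 := hP.trace
  rw [← Module.finrank_eq_rank, ← Module.finrank_eq_rank]
  congr 1
  have e1 : LinearMap.trace ℝ (n → ℝ) Q = ((LinearMap.trace ℚ (n → ℚ) P : ℚ) : ℝ) := by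
    rw [LinearMap.trace_eq_matrix_trace ℝ (Pi.basisFun ℝ n),
      LinearMap.trace_eq_matrix_trace ℚ (Pi.basisFun ℚ n), LinearMap.toMatrix_eq_toMatrix',
      LinearMap.toMatrix_eq_toMatrix', LinearMap.toMatrix'_toLin']
    simp [Matrix.trace, M]
  rw [t1, t2] at e1
  exact_mod_cast e1

/-! ### The torus and its characters -/

section LocalCircle

variable {K : Type*} [Field K]

theorem bijective_extend (v : InfinitePlace K) (φ : K →+* ℂ) (h : InfinitePlace.mk φ = v)
    (hv : v.IsComplex) : Function.Bijective (extend v φ h) := by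
  have hb := InfinitePlace.Completion.bijective_extensionEmbedding_of_isComplex hv
  rcases extend_eq_or v φ h with h1 | h1
  · rwa [← funext h1] at hb
  · rw [show (extend v φ h : v.Completion → ℂ) = starRingEnd ℂ ∘ _ from funext h1]
    exact (starRingAut (R := ℂ)).bijective.comp hb

theorem isometry_extend (v : InfinitePlace K) (φ : K →+* ℂ) (h : InfinitePlace.mk φ = v) :
    Isometry (extend v φ h) :=
  (isometry_of_mk_eq v φ h).completion_extension.comp
    (InfinitePlace.Completion.isometry_toCompletion v)

theorem re_extend_eq_zero_iff (v : InfinitePlace K) (φ : K →+* ℂ) (h : InfinitePlace.mk φ = v)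
    (z : v.Completion) : (extend v φ h z).re = 0 ↔ z ∈ R1 v := by
  change _ ↔ (InfinitePlace.Completion.extensionEmbedding v z).re = 0
  rcases extend_eq_or v φ h with h1 | h1 <;> simp [h1]

/-- The kernel of `z ↦ exp (φ z)` on `ℝ(1)_v` is `ℤ(1)_v`. -/
theorem expAt_injective (v : InfinitePlace K) (φ : K →+* ℂ) (h : InfinitePlace.mk φ = v) :
    Function.Injective (expAt v φ h) := by
  rw [injective_iff_map_eq_zero]
  intro t ht
  induction t using QuotientAddGroup.induction_on with
  | H z =>
    have h1 := coe_expAt v φ h z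
    rw [ht, toMul_zero, Circle.coe_one, eq_comm, Complex.exp_eq_one_iff] at h1
    obtain ⟨n, hn⟩ := h1
    rw [QuotientAddGroup.eq_zero_iff]
    rcases extend_eq_or v φ h with h2 | h2
    · exact ⟨n, by rw [← h2, hn]⟩
    · refine ⟨-n, ?_⟩
      have := congrArg (starRingEnd ℂ) hn
      rw [h2, Complex.conj_conj] at this
      rw [this]
      simp [Complex.conj_ofNat]

/-- For an embedding `φ` inducing the complex place `v`, the homomorphism from `ℝ` to
`ℝ(1)_v / ℤ(1)_v` sending `a` to the class of the `z ∈ k_v` with `φ z = i a`. -/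
def angle (v : InfinitePlace K) (φ : K →+* ℂ) (h : InfinitePlace.mk φ = v) (hv : v.IsComplex) :
    ℝ →+ R1 v ⧸ Z1 v :=
  (QuotientAddGroup.mk' (Z1 v)).comp <| AddMonoidHom.mk'
    (fun a => ⟨(RingEquiv.ofBijective _ (bijective_extend v φ h hv)).symm (a * Complex.I), by
      rw [← re_extend_eq_zero_iff v φ h]
      change ((RingEquiv.ofBijective _ (bijective_extend v φ h hv)) _).re = 0
      rw [RingEquiv.apply_symm_apply]
      simp⟩) (fun a b => Subtype.ext (by simp [add_mul]))

theorem expAt_angle (v : InfinitePlace K) (φ : K →+* ℂ) (h : InfinitePlace.mk φ = v)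
    (hv : v.IsComplex) (a : ℝ) : (expAt v φ h (angle v φ h hv a)).toMul = Circle.exp a := by
  refine Circle.ext ?_
  change (((expAt v φ h (QuotientAddGroup.mk _)).toMul : Circle) : ℂ) = _
  rw [coe_expAt, Circle.coe_exp]
  congr 1
  exact (RingEquiv.ofBijective _ (bijective_extend v φ h hv)).apply_symm_apply _

theorem continuous_angle (v : InfinitePlace K) (φ : K →+* ℂ) (h : InfinitePlace.mk φ = v)
    (hv : v.IsComplex) : Continuous (angle v φ h hv) := by
  refine continuous_quotient_mk'.comp (Continuous.subtype_mk ?_ _)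
  rw [(isometry_extend v φ h).isEmbedding.continuous_iff]
  have : (extend v φ h ∘ fun a : ℝ =>
      (RingEquiv.ofBijective _ (bijective_extend v φ h hv)).symm (a * Complex.I)) =
      fun a : ℝ => a * Complex.I :=
    funext fun a => (RingEquiv.ofBijective _ (bijective_extend v φ h hv)).apply_symm_apply _
  rw [this]
  fun_prop

theorem expAt_bijective (v : InfinitePlace K) (φ : K →+* ℂ) (h : InfinitePlace.mk φ = v)
    (hv : v.IsComplex) : Function.Bijective fun t => (expAt v φ h t).toMul := by
  refine ⟨expAt_injective v φ h, fun z => ?_⟩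
  obtain ⟨a, rfl⟩ := Circle.exp_surjective z
  exact ⟨_, expAt_angle v φ h hv a⟩

/-- The character `z ↦ exp (φ z)` as a homeomorphism from `ℝ(1)_v / ℤ(1)_v` to the circle. -/
def circleHomeo (v : InfinitePlace K) (φ : K →+* ℂ) (h : InfinitePlace.mk φ = v)
    (hv : v.IsComplex) : R1 v ⧸ Z1 v ≃ₜ Circle where
  toEquiv := Equiv.ofBijective _ (expAt_bijective v φ h hv)
  continuous_toFun := continuous_expAt v φ h
  continuous_invFun := by
    -- the inverse is continuous because `angle` is and `Circle.exp` is a quotient map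
    have hq : Topology.IsQuotientMap Circle.exp :=
      isLocalHomeomorph_circleExp.isOpenMap.isQuotientMap Circle.exp.continuous
        Circle.exp_surjective
    rw [hq.continuous_iff]
    convert continuous_angle v φ h hv using 1
    funext a
    rw [Function.comp_apply]
    exact (Equiv.ofBijective _ (expAt_bijective v φ h hv)).symm_apply_eq.mpr
      (expAt_angle v φ h hv a).symm

/-- The character `z ↦ exp (φ z)` inverts the logarithm, for either embedding `φ` inducing `v`. -/
theorem coe_expAt_logAt (v : InfinitePlace K) (φ : K →+* ℂ) (h : InfinitePlace.mk φ = v)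
    (hv : v.IsComplex) (x : Metric.sphere (0 : v.Completion) 1) :
    ((expAt v φ h (logAt v hv (Additive.ofMul x))).toMul : ℂ) = extend v φ h x := by
  change (((expAt v φ h (QuotientAddGroup.mk (logRep v hv x))).toMul : Circle) : ℂ) = _
  have hx : InfinitePlace.Completion.extensionEmbedding v x ≠ 0 := by
    rw [map_ne_zero]
    exact ne_zero_of_mem_unit_sphere x
  rw [coe_expAt]
  rcases extend_eq_or v φ h with h1 | h1
  · rw [h1, h1, extensionEmbedding_logRep, Complex.exp_log hx]
  · rw [h1, h1, extensionEmbedding_logRep, Complex.exp_conj, Complex.exp_log hx]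

end LocalCircle

section GlobalTorus

variable {K : Type*} [Field K] [IsTotallyComplex K]
variable (φ : InfinitePlace K → (K →+* ℂ)) (hφ : ∀ v, InfinitePlace.mk (φ v) = v)

/-- The torus `T_k` as a product of circles, through the characters `exp (φ_v t_v)`. -/
def torusHomeo : Torus K ≃ₜ (InfinitePlace K → Circle) :=
  Homeomorph.piCongrRight fun v => circleHomeo v (φ v) (hφ v) (IsTotallyComplex.isComplex v)

theorem torusHomeo_apply (t : Torus K) (v : InfinitePlace K) :
    torusHomeo φ hφ t v = (expAt v (φ v) (hφ v) (t v)).toMul := rfl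

theorem torusHomeo_add (s t : Torus K) :
    torusHomeo φ hφ (s + t) = torusHomeo φ hφ s * torusHomeo φ hφ t := by
  funext v
  simp [torusHomeo_apply]

theorem torusHomeo_zero : torusHomeo φ hφ 0 = 1 := by
  funext v
  simp [torusHomeo_apply]

theorem compactSpace_torus (φ : InfinitePlace K → (K →+* ℂ))
    (hφ : ∀ v, InfinitePlace.mk (φ v) = v) : CompactSpace (Torus K) :=
  (torusHomeo φ hφ).symm.compactSpace

/-- The exponential map of the torus `T_k`: the vector `a` goes to the element with coordinates
`exp (i a_v)` under `torusHomeo`. -/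
def lineMap : (InfinitePlace K → ℝ) →+ Torus K :=
  AddMonoidHom.mk' (fun a v => angle v (φ v) (hφ v) (IsTotallyComplex.isComplex v) (a v))
    (fun a b => by funext v; simp)

theorem continuous_lineMap : Continuous (lineMap φ hφ) :=
  continuous_pi fun v =>
    (continuous_angle v (φ v) (hφ v) (IsTotallyComplex.isComplex v)).comp (continuous_apply v)

theorem torusHomeo_lineMap (a : InfinitePlace K → ℝ) :
    torusHomeo φ hφ (lineMap φ hφ a) = fun v => Circle.exp (a v) :=
  funext fun v => expAt_angle v (φ v) (hφ v) (IsTotallyComplex.isComplex v) (a v)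

theorem lineMap_surjective : Function.Surjective (lineMap φ hφ) := by
  intro t
  choose a ha using fun v => Circle.exp_surjective (torusHomeo φ hφ t v)
  exact ⟨a, (torusHomeo φ hφ).injective (by rw [torusHomeo_lineMap]; exact funext ha)⟩

theorem exists_eq_lineMap (γ : ℝ → Torus K) (hγ : Continuous γ)
    (hadd : ∀ s t, γ (s + t) = γ s + γ t) :
    ∃ a : InfinitePlace K → ℝ, ∀ t : ℝ, γ t = lineMap φ hφ (t • a) := by
  have hc := (torusHomeo φ hφ).continuous.comp hγ
  choose a ha using fun v => exists_eq_circle_exp (fun t => torusHomeo φ hφ (γ t) v)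
    ((continuous_apply v).comp hc) (fun s t => by rw [hadd, torusHomeo_add, Pi.mul_apply])
  refine ⟨a, fun t => (torusHomeo φ hφ).injective ?_⟩
  rw [torusHomeo_lineMap]
  funext v
  rw [ha, Pi.smul_apply, smul_eq_mul, mul_comm]

variable [NumberField K]

theorem chi_apply (μ : InfinitePlace K → ℤ) (t : Torus K) :
    chi φ hφ μ (Multiplicative.ofAdd t) = monomial μ (torusHomeo φ hφ t) := rfl

theorem chi_lineMap (μ : InfinitePlace K → ℤ) (a : InfinitePlace K → ℝ) :
    chi φ hφ μ (Multiplicative.ofAdd (lineMap φ hφ a)) = Circle.exp (∑ v, μ v * a v) := by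
  rw [chi_apply, torusHomeo_lineMap, monomial_exp]

theorem chi_lineMap_smul_eq_one_iff (μ : InfinitePlace K → ℤ) (a : InfinitePlace K → ℝ) :
    (∀ t : ℝ, chi φ hφ μ (Multiplicative.ofAdd (lineMap φ hφ (t • a))) = 1) ↔
      ∑ v, μ v * a v = 0 := by
  have (t : ℝ) : chi φ hφ μ (Multiplicative.ofAdd (lineMap φ hφ (t • a))) =
      Circle.exp (t * ∑ v, μ v * a v) := by
    rw [chi_lineMap, Finset.mul_sum]
    congr 1
    exact Finset.sum_congr rfl fun v _ => by simp; ring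
  simp_rw [this]
  refine ⟨fun h => eq_of_circle_exp_mul (fun t => by rw [h, mul_zero, Circle.exp_zero]),
    fun h t => by rw [h, mul_zero, Circle.exp_zero]⟩

/-- The continuous characters of `T_k` are the `χ_μ`, each for a unique `μ`. The exponents of a
character are those of its restrictions to the coordinate lines, and they are integers because these
lines are closed with period `2π`. -/
theorem bijective_chi : Function.Bijective (chi φ hφ) := by
  classical
  have hs (v : InfinitePlace K) (t : ℝ) (μ : InfinitePlace K → ℤ) :
      chi φ hφ μ (Multiplicative.ofAdd (lineMap φ hφ (Pi.single v t))) =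
        Circle.exp (t * μ v) := by
    rw [chi_lineMap, Finset.sum_eq_single v]
    · rw [Pi.single_eq_same, mul_comm]
    · intro w _ hw
      rw [Pi.single_eq_of_ne hw, mul_zero]
    · simp
  constructor
  · intro μ ν h
    funext v
    have : (μ v : ℝ) = ν v := eq_of_circle_exp_mul fun t => by rw [← hs, ← hs, h]
    exact_mod_cast this
  · intro χ
    have hc : Continuous χ := map_continuous χ
    have hsum (a : InfinitePlace K → ℝ) : χ (Multiplicative.ofAdd (lineMap φ hφ a)) =
        ∏ v, χ (Multiplicative.ofAdd (lineMap φ hφ (Pi.single v (a v)))) := by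
      rw [← map_prod, ← ofAdd_sum, ← map_sum, Finset.univ_sum_single]
    choose b hb using fun v => exists_eq_circle_exp
      (fun t => χ (Multiplicative.ofAdd (lineMap φ hφ (Pi.single v t))))
      (hc.comp (continuous_ofAdd.comp ((continuous_lineMap φ hφ).comp
        (continuous_single (A := fun _ => ℝ) v))))
      (fun s t => by rw [Pi.single_add, map_add, ofAdd_add, map_mul])
    have hint (v) : ∃ m : ℤ, b v = m := by
      have h0 : lineMap φ hφ (Pi.single v (2 * Real.pi)) = 0 := by
        refine (torusHomeo φ hφ).injective ?_
        rw [torusHomeo_lineMap, torusHomeo_zero]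
        funext w
        rcases eq_or_ne w v with rfl | hw
        · simp
        · simp [Pi.single_eq_of_ne hw]
      have := hb v (2 * Real.pi)
      rw [h0, ofAdd_zero, map_one, eq_comm, Circle.exp_eq_one] at this
      obtain ⟨m, hm⟩ := this
      exact ⟨m, mul_right_cancel₀ (by positivity) hm⟩
    choose μ hμ using hint
    refine ⟨μ, PontryaginDual.ext fun t => ?_⟩
    obtain ⟨a, ha⟩ := lineMap_surjective φ hφ t.toAdd
    rw [← ofAdd_toAdd t, ← ha, hsum, chi_apply, torusHomeo_lineMap, monomial_apply]
    refine Finset.prod_congr rfl fun v _ => ?_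
    rw [hb, hμ, ← Circle.exp_zsmul, zsmul_eq_mul]

theorem torusHomeo_alpha (p : ℕ) (x : weilUnits K p) (v : InfinitePlace K) :
    ((torusHomeo φ hφ (alpha K p (Additive.ofMul x)) v : Circle) : ℂ) = φ v ((x : Kˣ) : K) := by
  rw [torusHomeo_apply]
  refine (coe_expAt_logAt v (φ v) (hφ v) (IsTotallyComplex.isComplex v) (diag K p v x)).trans ?_
  exact extend_coe v (φ v) (hφ v) _

/-- The closure of the image of `E_p(k)` is the common kernel of the `χ_μ` that are trivial on the
image. -/
theorem mem_imageClosure_iff (p : ℕ) (t : Torus K) :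
    t ∈ imageClosure K p ↔ ∀ μ : InfinitePlace K → ℤ,
      (∀ x, chi φ hφ μ (Multiplicative.ofAdd (alpha K p x)) = 1) →
        chi φ hφ μ (Multiplicative.ofAdd t) = 1 := by
  constructor
  · intro ht μ hμ
    have hc : IsClosed {t | chi φ hφ μ (Multiplicative.ofAdd t) = 1} :=
      isClosed_eq ((map_continuous (chi φ hφ μ)).comp continuous_ofAdd) continuous_const
    have : (closure (Set.range (alpha K p))) ⊆ {t | chi φ hφ μ (Multiplicative.ofAdd t) = 1} :=
      closure_minimal (by rintro - ⟨x, rfl⟩; exact hμ x) hc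
    exact this ht
  · intro h
    let Φ : Torus K →+ Additive (InfinitePlace K → Circle) :=
      AddMonoidHom.mk' (fun t => Additive.ofMul (torusHomeo φ hφ t))
        (fun s t => congrArg Additive.ofMul (torusHomeo_add φ hφ s t))
    let H : Subgroup (InfinitePlace K → Circle) :=
      AddSubgroup.toSubgroup' ((imageClosure K p).map Φ)
    have hH : (H : Set (InfinitePlace K → Circle)) = torusHomeo φ hφ '' imageClosure K p := rfl
    have hcl : IsClosed (imageClosure K p : Set (Torus K)) :=
      AddSubgroup.isClosed_topologicalClosure _
    have := mem_of_forall_monomial H (by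
      rw [hH]; exact (torusHomeo φ hφ).isClosedMap _ hcl) (torusHomeo φ hφ t) (by
      intro μ hμ
      refine h μ fun x => hμ _ ?_
      exact ⟨_, subset_closure ⟨x, rfl⟩, rfl⟩)
    obtain ⟨s, hs, hst⟩ := this
    rwa [← (torusHomeo φ hφ).injective hst]

end GlobalTorus

/-! ### Orders at primes and the action of the Galois group -/

section Ord

open IsDedekindDomain

variable {K : Type*} [Field K] [NumberField K]

open scoped Classical in
/-- The order of `x` at the ideal `P`. It is set to `0` when `P` is zero or not prime, which makes
it equivariant under the action of the Galois group on all ideals; it also is `0` at `x = 0`. -/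
def ord (P : Ideal (𝓞 K)) (x : K) : ℤ :=
  if h : P.IsPrime ∧ P ≠ ⊥ then
    -WithZero.log ((⟨P, h.1, h.2⟩ : HeightOneSpectrum (𝓞 K)).valuation K x) else 0

theorem ord_asIdeal (q : HeightOneSpectrum (𝓞 K)) (x : K) :
    ord q.asIdeal x = -WithZero.log (q.valuation K x) :=
  dif_pos ⟨q.isPrime, q.ne_bot⟩

theorem ord_asIdeal_eq_zero_iff (q : HeightOneSpectrum (𝓞 K)) {x : K} (hx : x ≠ 0) :
    ord q.asIdeal x = 0 ↔ q.valuation K x = 1 := by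
  have h : q.valuation K x ≠ 0 := (Valuation.ne_zero_iff _).mpr hx
  rw [ord_asIdeal, neg_eq_zero]
  refine ⟨fun h1 => ?_, fun h1 => by rw [h1, WithZero.log_one]⟩
  rw [← WithZero.exp_log h, h1, WithZero.exp_zero]

theorem ord_mul (P : Ideal (𝓞 K)) {x y : K} (hx : x ≠ 0) (hy : y ≠ 0) :
    ord P (x * y) = ord P x + ord P y := by
  unfold ord
  split_ifs with h
  · rw [map_mul, WithZero.log_mul ((Valuation.ne_zero_iff _).mpr hx)
      ((Valuation.ne_zero_iff _).mpr hy), neg_add]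
  · simp

/-- The order at `P` as a homomorphism on `kˣ`. -/
def ordHom (P : Ideal (𝓞 K)) : Additive Kˣ →+ ℤ :=
  AddMonoidHom.mk' (fun x => ord P (x.toMul : K)) fun x y =>
    ord_mul P x.toMul.ne_zero y.toMul.ne_zero

theorem ordHom_apply (P : Ideal (𝓞 K)) (x : Kˣ) : ordHom P (Additive.ofMul x) = ord P (x : K) := rfl

theorem ord_algebraMap_eq_zero (P : Ideal (𝓞 K)) {r : 𝓞 K} (hr : r ∉ P) :
    ord P (algebraMap (𝓞 K) K r) = 0 := by
  unfold ord
  split_ifs with h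
  · have : (⟨P, h.1, h.2⟩ : HeightOneSpectrum (𝓞 K)).valuation K (algebraMap (𝓞 K) K r) = 1 :=
      (HeightOneSpectrum.valuation_eq_one_iff_notMem _).mpr hr
    rw [this, WithZero.log_one, neg_zero]
  · rfl

theorem ord_algebraMap_ne_zero (P : Ideal (𝓞 K)) [hP : P.IsPrime] {r : 𝓞 K} (h0 : r ≠ 0)
    (hr : r ∈ P) :
    ord P (algebraMap (𝓞 K) K r) ≠ 0 := by
  let q : HeightOneSpectrum (𝓞 K) := ⟨P, hP, fun h => h0 (by simpa [h] using hr)⟩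
  intro h
  rw [show P = q.asIdeal from rfl, ord_asIdeal_eq_zero_iff q (by simpa using h0)] at h
  exact (HeightOneSpectrum.valuation_eq_one_iff_notMem _).mp h hr

theorem isPrime_smul {g : Gal(K/ℚ)} {P : Ideal (𝓞 K)} (h : P.IsPrime) : (g • P).IsPrime := by
  infer_instance

theorem smul_ne_bot {g : Gal(K/ℚ)} {P : Ideal (𝓞 K)} (h : P ≠ ⊥) : g • P ≠ ⊥ := by
  rwa [Ne, smul_eq_iff_eq_inv_smul, Ideal.smul_bot]

theorem ord_smul_algebraMap (g : Gal(K/ℚ)) (P : Ideal (𝓞 K)) {r : 𝓞 K} (hr : r ≠ 0) :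
    ord (g • P) (algebraMap (𝓞 K) K (g • r)) = ord P (algebraMap (𝓞 K) K r) := by
  by_cases h : P.IsPrime ∧ P ≠ ⊥
  · let q : HeightOneSpectrum (𝓞 K) := ⟨P, h.1, h.2⟩
    let q' : HeightOneSpectrum (𝓞 K) := ⟨g • P, isPrime_smul h.1, smul_ne_bot h.2⟩
    have hr' : g • r ≠ 0 := by rwa [Ne, smul_eq_zero_iff_eq]
    change ord q'.asIdeal _ = ord q.asIdeal _
    rw [ord_asIdeal, ord_asIdeal, HeightOneSpectrum.valuation_of_algebraMap,
      HeightOneSpectrum.valuation_of_algebraMap]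
    have key (n : ℕ) : q'.intValuation (g • r) ≤ WithZero.exp (-(n : ℤ)) ↔
        q.intValuation r ≤ WithZero.exp (-(n : ℤ)) := by
      rw [HeightOneSpectrum.intValuation_le_pow_iff_mem,
        HeightOneSpectrum.intValuation_le_pow_iff_mem]
      change g • r ∈ (g • P) ^ n ↔ r ∈ P ^ n
      rw [← smul_pow', Ideal.smul_mem_pointwise_smul_iff]
    have : q'.intValuation (g • r) = q.intValuation r := by
      apply le_antisymm
      · have := key
        rw [q.intValuation_if_neg hr] at this ⊢
        exact (this _).mpr le_rfl
      · have := key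
        rw [q'.intValuation_if_neg hr'] at this ⊢
        exact (this _).mp le_rfl
    rw [this]
  · have h' : ¬ ((g • P).IsPrime ∧ g • P ≠ ⊥) := fun h' => h (by
      have h1 := isPrime_smul (g := g⁻¹) h'.1
      have h2 := smul_ne_bot (g := g⁻¹) h'.2
      rw [inv_smul_smul] at h1 h2
      exact ⟨h1, h2⟩)
    rw [ord, ord, dif_neg h, dif_neg h']

theorem ord_smul (g : Gal(K/ℚ)) (P : Ideal (𝓞 K)) (x : K) :
    ord (g • P) (g x) = ord P x := by
  rcases eq_or_ne x 0 with rfl | hx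
  · simp [ord]
  obtain ⟨r, s, hs, rfl⟩ := IsFractionRing.div_surjective (𝓞 K) x
  have hs0 : s ≠ 0 := nonZeroDivisors.ne_zero hs
  have hr0 : r ≠ 0 := by rintro rfl; simp at hx
  have e (t : 𝓞 K) : g (algebraMap (𝓞 K) K t) = algebraMap (𝓞 K) K (g • t) := rfl
  have a0 {t : 𝓞 K} (ht : t ≠ 0) : algebraMap (𝓞 K) K t ≠ 0 := by simpa using ht
  have h1 := ord_mul P hx (a0 hs0)
  have h2 := ord_mul (g • P) (x := g (algebraMap (𝓞 K) K r / algebraMap (𝓞 K) K s))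
    (y := g (algebraMap (𝓞 K) K s)) (by simpa using hx) (by simpa using hs0)
  rw [← map_mul, div_mul_cancel₀ _ (a0 hs0), e, e, ord_smul_algebraMap g P hr0,
    ord_smul_algebraMap g P hs0] at h2
  rw [div_mul_cancel₀ _ (a0 hs0)] at h1
  linarith

theorem ord_apply (g : Gal(K/ℚ)) (P : Ideal (𝓞 K)) (x : K) :
    ord P (g x) = ord (g⁻¹ • P) x := by
  rw [← ord_smul g (g⁻¹ • P), smul_inv_smul]

/-- A generator of a principal power of `P`, given by the finiteness of the class group, lies in no
other prime. -/
theorem exists_mem_forall_mem_prime (P : Ideal (𝓞 K)) [P.IsPrime] (h0 : P ≠ ⊥) :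
    ∃ r : 𝓞 K, r ≠ 0 ∧ r ∈ P ∧ ∀ Q : Ideal (𝓞 K), Q.IsPrime → r ∈ Q → Q = P := by
  have hmem : P ∈ nonZeroDivisors (Ideal (𝓞 K)) := mem_nonZeroDivisors_of_ne_zero h0
  obtain ⟨n, hn, h1⟩ := isOfFinOrder_iff_pow_eq_one.mp
    (isOfFinOrder_of_finite (ClassGroup.mk0 ⟨P, hmem⟩))
  rw [← map_pow, ClassGroup.mk0_eq_one_iff] at h1
  obtain ⟨r, hr⟩ := h1
  change P ^ n = Ideal.span {r} at hr
  have hrP : r ∈ P ^ n := by rw [hr]; exact Ideal.mem_span_singleton_self r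
  refine ⟨r, ?_, Ideal.pow_le_self hn.ne' hrP, fun Q hQ hrQ => ?_⟩
  · rintro rfl
    rw [Ideal.span_singleton_eq_bot.mpr rfl] at hr
    exact h0 (pow_eq_zero_iff hn.ne' |>.mp hr)
  · have h2 : P ^ n ≤ Q := by rwa [hr, Ideal.span_singleton_le_iff_mem]
    have h3 : P.IsMaximal := Ideal.IsPrime.isMaximal inferInstance h0
    exact (h3.eq_of_le hQ.ne_top (hQ.le_of_pow_le h2)).symm

end Ord

section WeilUnits

open IsDedekindDomain

variable {K : Type*} [Field K] [NumberField K]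

theorem mem_weilUnits_iff {p : ℕ} {x : Kˣ} : x ∈ weilUnits K p ↔
    (∀ v : InfinitePlace K, v (x : K) = 1) ∧
      ∀ P : Ideal (𝓞 K), (p : 𝓞 K) ∉ P → ord P (x : K) = 0 := by
  refine and_congr_right fun _ => ⟨fun h P hP => ?_, fun h q hq => ?_⟩
  · by_cases h' : P.IsPrime ∧ P ≠ ⊥
    · exact (ord_asIdeal_eq_zero_iff ⟨P, h'.1, h'.2⟩ x.ne_zero).mpr (h _ hP)
    · rw [ord, dif_neg h']
  · exact (ord_asIdeal_eq_zero_iff q x.ne_zero).mp (h _ hq)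

/-- The action of a Galois automorphism on `kˣ`. -/
def galUnits (g : Gal(K/ℚ)) : Kˣ →* Kˣ := Units.map (g : K →* K)

theorem coe_galUnits (g : Gal(K/ℚ)) (x : Kˣ) : (galUnits g x : K) = g x := rfl

theorem natCast_mem_smul_iff (g : Gal(K/ℚ)) (P : Ideal (𝓞 K)) (p : ℕ) :
    (p : 𝓞 K) ∈ g • P ↔ (p : 𝓞 K) ∈ P := by
  have : g • (p : 𝓞 K) = p := map_natCast (MulSemiringAction.toRingHom Gal(K/ℚ) (𝓞 K) g) p
  rw [← this, Ideal.smul_mem_pointwise_smul_iff, this]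

theorem galUnits_mem {p : ℕ} {x : Kˣ} (g : Gal(K/ℚ)) (hx : x ∈ weilUnits K p) :
    galUnits g x ∈ weilUnits K p := by
  rw [mem_weilUnits_iff] at hx ⊢
  refine ⟨fun v => hx.1 (v.comap (g : K →+* K)), fun P hP => ?_⟩
  rw [coe_galUnits, ord_apply]
  exact hx.2 _ (by rwa [natCast_mem_smul_iff])

theorem norm_embedding_eq_one {p : ℕ} {x : Kˣ} (hx : x ∈ weilUnits K p) (φ : K →+* ℂ) :
    ‖φ x‖ = 1 := by
  rw [← InfinitePlace.apply]
  exact hx.1 (InfinitePlace.mk φ)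

/-- An element of `E_p(k)` whose orders at the primes over `p` vanish is a unit of absolute value
`1` at all infinite places, hence a root of unity by Kronecker's theorem. -/
theorem pow_torsionOrder_eq_one {p : ℕ} {x : Kˣ} (hx : x ∈ weilUnits K p)
    (h : ∀ P : Ideal (𝓞 K), (p : 𝓞 K) ∈ P → ord P (x : K) = 0) :
    x ^ Units.torsionOrder K = 1 := by
  have hv {y : Kˣ} (hy : y ∈ weilUnits K p)
      (h : ∀ P : Ideal (𝓞 K), (p : 𝓞 K) ∈ P → ord P (y : K) = 0) :
      ∃ r : 𝓞 K, algebraMap (𝓞 K) K r = y := by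
    refine HeightOneSpectrum.mem_integers_of_valuation_le_one K (y : K) fun q => le_of_eq ?_
    rw [← ord_asIdeal_eq_zero_iff q y.ne_zero]
    by_cases hq : (p : 𝓞 K) ∈ q.asIdeal
    · exact h _ hq
    · exact (mem_weilUnits_iff.mp hy).2 _ hq
  obtain ⟨r, hr⟩ := hv hx h
  obtain ⟨s, hs⟩ := hv (inv_mem hx) (fun P hP => by
    have h1 := map_neg (ordHom P) (Additive.ofMul x)
    rw [← ofMul_inv, ordHom_apply, ordHom_apply, h P hP, neg_zero] at h1
    exact h1)
  have hinj := RingOfIntegers.coe_injective (K := K)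
  let u : (𝓞 K)ˣ := ⟨r, s, hinj (by simp [hr, hs]), hinj (by simp [hr, hs])⟩
  have hu : u ∈ Units.torsion K := by
    rw [Units.mem_torsion]
    intro w
    change w (algebraMap (𝓞 K) K r) = 1
    rw [hr]
    exact hx.1 w
  have h1 : (⟨u, hu⟩ : Units.torsion K) ^ Units.torsionOrder K = 1 := pow_card_eq_one'
  have h2 : r ^ Units.torsionOrder K = 1 :=
    congrArg (fun t : Units.torsion K => ((t : (𝓞 K)ˣ) : 𝓞 K)) h1
  ext
  rw [Units.val_pow_eq_pow_val, ← hr, ← map_pow, h2, map_one, Units.val_one]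

/-- The product `∏ v, σ_v(x) ^ μ_v`, whose image under `ι` is the value of `χ_μ` at the image of
`x ∈ E_p(k)` in the torus. -/
def galProd (σ : InfinitePlace K → Gal(K/ℚ)) (μ : InfinitePlace K → ℤ) (x : Kˣ) : Kˣ :=
  ∏ v, galUnits (σ v) x ^ μ v

theorem galProd_mem (σ : InfinitePlace K → Gal(K/ℚ)) (μ : InfinitePlace K → ℤ) {p : ℕ} {x : Kˣ}
    (hx : x ∈ weilUnits K p) : galProd σ μ x ∈ weilUnits K p :=
  prod_mem fun v _ => zpow_mem (galUnits_mem (σ v) hx) _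

theorem ord_galProd (σ : InfinitePlace K → Gal(K/ℚ)) (μ : InfinitePlace K → ℤ) (x : Kˣ)
    (P : Ideal (𝓞 K)) :
    ord P (galProd σ μ x : K) = ∑ v, μ v * ord ((σ v)⁻¹ • P) (x : K) := by
  rw [← ordHom_apply, galProd, ofMul_prod, map_sum]
  refine Finset.sum_congr rfl fun v _ => ?_
  rw [ofMul_zpow, map_zsmul, ordHom_apply, coe_galUnits, ord_apply, smul_eq_mul]

variable [IsCMField K]

theorem conj_apply (x : K) : conj K x = IsCMField.complexConj K x := rfl

theorem embedding_conj (φ : K →+* ℂ) (x : K) : φ (conj K x) = starRingEnd ℂ (φ x) :=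
  IsCMField.complexEmbedding_complexConj K φ x

/-- Complex conjugation is central, because every embedding turns it into the conjugation of `ℂ`. -/
theorem conj_mul_comm (g : Gal(K/ℚ)) : conj K * g = g * conj K := by
  let φ : K →+* ℂ := Classical.arbitrary _
  ext x
  apply φ.injective
  have := embedding_conj (φ.comp (g : K →+* K)) x
  rw [AlgEquiv.mul_apply, embedding_conj]
  exact this.symm

theorem conj_mul_self : conj K * conj K = 1 := by
  ext x
  exact IsCMField.complexConj_apply_apply K x

theorem conj_inv : (conj K)⁻¹ = conj K := inv_eq_of_mul_eq_one_left conj_mul_self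

theorem conj_ne_one : conj K ≠ 1 := by
  intro h
  refine IsCMField.complexConj_ne_one K ?_
  ext x
  exact DFunLike.congr_fun h x

theorem conj_smul_smul (g : Gal(K/ℚ)) (P : Ideal (𝓞 K)) : conj K • g • P = g • conj K • P := by
  rw [smul_smul, smul_smul, conj_mul_comm]

theorem conj_smul_conj_smul (P : Ideal (𝓞 K)) : conj K • conj K • P = P := by
  rw [smul_smul, conj_mul_self, one_smul]

theorem mul_conj_eq_one {p : ℕ} {x : Kˣ} (hx : x ∈ weilUnits K p) :
    (x : K) * conj K x = 1 := by
  let φ : K →+* ℂ := Classical.arbitrary _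
  apply φ.injective
  rw [map_mul, embedding_conj, Complex.mul_conj, Complex.normSq_eq_norm_sq,
    norm_embedding_eq_one hx]
  simp

theorem ord_conj_smul {p : ℕ} {x : Kˣ} (hx : x ∈ weilUnits K p) (P : Ideal (𝓞 K)) :
    ord (conj K • P) (x : K) = -ord P (x : K) := by
  have h := ord_mul P x.ne_zero (galUnits (conj K) x).ne_zero
  rw [coe_galUnits, mul_conj_eq_one hx, ord_apply, conj_inv] at h
  have h1 : ord P (1 : K) = 0 := by simp [ord]
  linarith

theorem ord_eq_zero_of_conj_smul {p : ℕ} {x : Kˣ} (hx : x ∈ weilUnits K p) {P : Ideal (𝓞 K)}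
    (hP : conj K • P = P) : ord P (x : K) = 0 := by
  have := ord_conj_smul hx P
  rw [hP] at this
  omega

end WeilUnits

section Epsilon

open IsDedekindDomain

variable {K : Type*} [Field K] [NumberField K] [IsCMField K] {p : ℕ}

theorem isPrime_of_mem_primesT {P : Ideal (𝓞 K)} (hP : P ∈ primesT K p) : P.IsPrime := hP.1.1

theorem natCast_mem_of_mem_primesT {P : Ideal (𝓞 K)} (hP : P ∈ primesT K p) : (p : 𝓞 K) ∈ P := by
  have h : Ideal.span {(p : ℤ)} = P.under ℤ := hP.1.2.over
  have : (p : ℤ) ∈ P.under ℤ := h ▸ Ideal.mem_span_singleton_self _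
  simpa [Ideal.mem_comap] using this

theorem ne_bot_of_mem_primesT (hp : p ≠ 0) {P : Ideal (𝓞 K)} (hP : P ∈ primesT K p) : P ≠ ⊥ := by
  rintro rfl
  have := natCast_mem_of_mem_primesT hP
  simp [hp] at this

theorem isMaximal_span_of_prime (hp : p.Prime) : (Ideal.span {(p : ℤ)}).IsMaximal :=
  PrincipalIdealRing.isMaximal_of_irreducible (Nat.prime_iff_prime_int.mp hp).irreducible

theorem mem_primesT_of_natCast_mem (hp : p.Prime) {P : Ideal (𝓞 K)} (h1 : P.IsPrime)
    (h2 : (p : 𝓞 K) ∈ P) (h3 : conj K • P ≠ P) : P ∈ primesT K p := by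
  refine ⟨⟨h1, ⟨?_⟩⟩, h3⟩
  refine (isMaximal_span_of_prime hp).eq_of_le (Ideal.IsPrime.under ℤ P).ne_top ?_
  rw [Ideal.span_singleton_le_iff_mem, Ideal.mem_comap]
  simpa using h2

theorem smul_mem_primesT (hp : p.Prime) (g : Gal(K/ℚ)) {P : Ideal (𝓞 K)} (hP : P ∈ primesT K p) :
    g • P ∈ primesT K p := by
  refine mem_primesT_of_natCast_mem hp (isPrime_smul (isPrime_of_mem_primesT hP))
    (by rw [natCast_mem_smul_iff]; exact natCast_mem_of_mem_primesT hP) ?_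
  rw [conj_smul_smul]
  exact fun h => hP.2 (smul_left_cancel g h)

/-- For `P ∈ 𝒯`, the quotient `y / c y` for a generator `y` of a power of `P` is an element of
`E_p(k)` whose order is nonzero at `P` and vanishes at all primes other than `P` and `c P`. -/
theorem exists_mem_weilUnits_ord (hp : p ≠ 0) {P : Ideal (𝓞 K)} (hP : P ∈ primesT K p) :
    ∃ x ∈ weilUnits K p, ord P (x : K) ≠ 0 ∧
      ∀ Q : Ideal (𝓞 K), Q ≠ P → Q ≠ conj K • P → ord Q (x : K) = 0 := by
  have := isPrime_of_mem_primesT hP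
  obtain ⟨r, hr0, hrP, hr⟩ := exists_mem_forall_mem_prime P (ne_bot_of_mem_primesT hp hP)
  have hr0' : algebraMap (𝓞 K) K r ≠ 0 := by simpa using hr0
  let y : Kˣ := Units.mk0 _ hr0'
  have hz {Q : Ideal (𝓞 K)} (hQ : Q ≠ P) : ord Q (y : K) = 0 := by
    by_cases h : r ∈ Q ∧ Q.IsPrime
    · exact absurd (hr Q h.2 h.1) hQ
    · rw [not_and_or] at h
      rcases h with h | h
      · exact ord_algebraMap_eq_zero Q h
      · rw [ord, dif_neg fun h' => h h'.1]
  have hx (Q : Ideal (𝓞 K)) : ord Q ((y / galUnits (conj K) y : Kˣ) : K) =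
      ord Q (y : K) - ord (conj K • Q) (y : K) := by
    rw [← ordHom_apply, ofMul_div, map_sub, ordHom_apply, ordHom_apply, coe_galUnits, ord_apply,
      conj_inv]
  have hx0 (Q : Ideal (𝓞 K)) (h1 : Q ≠ P) (h2 : Q ≠ conj K • P) :
      ord Q ((y / galUnits (conj K) y : Kˣ) : K) = 0 := by
    rw [hx, hz h1, hz (fun h => h2 (by rw [← h, conj_smul_conj_smul])), sub_zero]
  refine ⟨y / galUnits (conj K) y, mem_weilUnits_iff.mpr ⟨fun v => ?_, fun Q hQ => ?_⟩, ?_, hx0⟩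
  · rw [Units.val_div_eq_div_val, map_div₀, coe_galUnits, conj_apply,
      IsCMField.infinitePlace_complexConj, div_self]
    simp
  · refine hx0 Q ?_ ?_
    · rintro rfl
      exact hQ (natCast_mem_of_mem_primesT hP)
    · rintro rfl
      exact hQ (by rw [natCast_mem_smul_iff]; exact natCast_mem_of_mem_primesT hP)
  · rw [hx, hz hP.2, sub_zero]
    exact ord_algebraMap_ne_zero P hr0 hrP

variable {σ : InfinitePlace K → Gal(K/ℚ)}

/-- If `∏ v, σ_v(x) ^ μ_v = 1` for all `x ∈ E_p(k)`, then `μ` is orthogonal to the `ε_{P,P'}`: the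
order at `P'` of this product is `⟨μ, ε_{P,P'}⟩ ord_P(x)` when the orders of `x` vanish outside `P`
and `c P`. -/
theorem sum_mul_eps_eq_zero_of_galProd_eq_one (hp : p.Prime) {μ : InfinitePlace K → ℤ}
    (hμ : ∀ x ∈ weilUnits K p, galProd σ μ x = 1) {P P' : Ideal (𝓞 K)} (hP : P ∈ primesT K p) :
    ∑ v, μ v * eps σ P P' v = 0 := by
  obtain ⟨x, hx, hx0, hxQ⟩ := exists_mem_weilUnits_ord hp.ne_zero hP
  have h1 := ord_galProd σ μ x P'
  rw [hμ x hx, Units.val_one, show ord P' (1 : K) = 0 by simp [ord]] at h1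
  have h2 (v : InfinitePlace K) : ord ((σ v)⁻¹ • P') (x : K) = eps σ P P' v * ord P (x : K) := by
    unfold eps
    split_ifs with h h'
    · rw [← h, inv_smul_smul, one_mul]
    · have : conj K • P = (σ v)⁻¹ • P' := by
        rw [eq_inv_smul_iff, ← conj_smul_smul, h', conj_smul_conj_smul]
      rw [← this, ord_conj_smul hx, neg_one_mul]
    · rw [zero_mul]
      refine hxQ _ (fun h1 => h ?_) (fun h1 => h' ?_)
      · rw [← h1, smul_inv_smul]
      · have h3 := congrArg (fun Q => conj K • σ v • Q) h1
        simp only [smul_inv_smul] at h3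
        rw [h3, conj_smul_smul, conj_smul_conj_smul]
  simp_rw [h2, ← mul_assoc, ← Finset.sum_mul] at h1
  exact (mul_eq_zero.mp h1.symm).resolve_right hx0

variable {S : Set (Ideal (𝓞 K))}

theorem finite_of_isRepSystem (hp : p.Prime) (hS : IsRepSystem K p S) : S.Finite := by
  have := isMaximal_span_of_prime hp
  exact (IsDedekindDomain.primesOver_finite (Ideal.span {(p : ℤ)}) (𝓞 K)).subset
    fun _ hP => (hS.1 hP).1

/-- Only the representative in `S` of the class of `σ_v⁻¹ P'` contributes to the sum. -/
theorem ord_inv_smul_eq_sum (hp : p.Prime) (hS : IsRepSystem K p S) {x : Kˣ}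
    (hx : x ∈ weilUnits K p) {P' : Ideal (𝓞 K)} (hP' : P' ∈ primesT K p) (v : InfinitePlace K) :
    ord ((σ v)⁻¹ • P') (x : K) =
      ∑ P ∈ (finite_of_isRepSystem hp hS).toFinset, eps σ P P' v * ord P (x : K) := by
  obtain ⟨P, ⟨hP, hP1⟩, hP2⟩ := hS.2 _ (smul_mem_primesT hp (σ v)⁻¹ hP')
  rw [Finset.sum_eq_single_of_mem P (by simpa using hP)]
  · unfold eps
    rcases hP1 with rfl | rfl
    · rw [if_pos (smul_inv_smul _ _), one_mul]
    · rw [← conj_smul_smul, smul_inv_smul, if_neg hP'.2, if_pos rfl, ord_conj_smul hx]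
      simp
  · intro Q hQ hne
    have hQ' : Q ∈ S := by simpa using hQ
    rw [eps, if_neg, if_neg, zero_mul]
    · intro h
      refine hne (hP2 Q ⟨hQ', Or.inr ?_⟩)
      rw [conj_smul_smul, eq_inv_smul_iff, h]
    · intro h
      exact hne (hP2 Q ⟨hQ', Or.inl (eq_inv_smul_iff.mpr h)⟩)

/-- For `μ` orthogonal to the `ε_{P,P'}`, the elements `∏ v, σ_v(x) ^ μ_v` with `x ∈ E_p(k)` have
order zero at all primes, so they are roots of unity. -/
theorem galProd_pow_torsionOrder_eq_one (hp : p.Prime) (hS : IsRepSystem K p S)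
    {μ : InfinitePlace K → ℤ} (hμ : μ ∈ orthEps σ S) {x : Kˣ} (hx : x ∈ weilUnits K p) :
    galProd σ μ x ^ Units.torsionOrder K = 1 := by
  have hy := galProd_mem σ μ hx
  have hT {P' : Ideal (𝓞 K)} (hP' : P' ∈ S) : ord P' (galProd σ μ x : K) = 0 := by
    rw [ord_galProd]
    simp_rw [ord_inv_smul_eq_sum hp hS hx (hS.1 hP'), Finset.mul_sum]
    rw [Finset.sum_comm]
    refine Finset.sum_eq_zero fun P hP => ?_
    simp_rw [← mul_assoc]
    rw [← Finset.sum_mul, hμ P (by simpa using hP) P' hP', zero_mul]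
  refine pow_torsionOrder_eq_one hy fun P hP => ?_
  by_cases hprime : P.IsPrime
  · by_cases hc : conj K • P = P
    · exact ord_eq_zero_of_conj_smul hy hc
    · obtain ⟨Q, ⟨hQ, hQP⟩, -⟩ := hS.2 P (mem_primesT_of_natCast_mem hp hprime hP hc)
      rcases hQP with rfl | rfl
      · exact hT hQ
      · have := hT hQ
        rwa [ord_conj_smul hy, neg_eq_zero] at this
  · rw [ord, dif_neg fun h => hprime h.1]

end Epsilon

/-! ### The closure of the image -/

/-- A continuous character that is trivial on the subgroup `N` descends to the quotient by `N`. -/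
theorem exists_pontryaginDual_quotient {A : Type*} [AddCommGroup A] [TopologicalSpace A]
    (N : AddSubgroup A) (χ : PontryaginDual (Multiplicative A))
    (hχ : ∀ t ∈ N, χ (Multiplicative.ofAdd t) = 1) :
    ∃ ψ : PontryaginDual (Multiplicative (A ⧸ N)),
      ∀ t : A, ψ (Multiplicative.ofAdd (QuotientAddGroup.mk t)) = χ (Multiplicative.ofAdd t) := by
  let f : A ⧸ N →+ Additive Circle := QuotientAddGroup.lift N
    (AddMonoidHom.mk' (fun t => Additive.ofMul (χ (Multiplicative.ofAdd t)))
      (fun s t => by rw [ofAdd_add, map_mul, ofMul_mul])) (fun t ht => hχ t ht)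
  have hf : Continuous fun t => (f t).toMul := by
    refine (QuotientAddGroup.isQuotientMap_mk N).continuous_iff.mpr ?_
    exact (map_continuous χ).comp continuous_ofAdd
  exact ⟨(⟨MonoidHom.mk' (fun t => (f t.toAdd).toMul) (fun s t => by
      rw [toAdd_mul, map_add, toMul_add]), hf.comp continuous_toAdd⟩ :
    Multiplicative (A ⧸ N) →ₜ* Circle), fun t => rfl⟩

/-- A continuous function to the `N`-th roots of unity is constant on preconnected sets. -/
theorem eq_of_pow_eq_one_of_isPreconnected {X : Type*} [TopologicalSpace X] {s : Set X}
    (hs : IsPreconnected s) {f : X → Circle} (hf : Continuous f) {N : ℕ} (hN : 0 < N)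
    (hfN : ∀ x ∈ s, f x ^ N = 1) {x y : X} (hx : x ∈ s) (hy : y ∈ s) : f x = f y := by
  have hfin : {z : Circle | z ^ N = 1}.Finite := by
    refine Set.Finite.of_finite_image (f := fun z : Circle => (z : ℂ)) ?_ Circle.coe_injective.injOn
    refine (Polynomial.nthRoots N (1 : ℂ)).toFinset.finite_toSet.subset ?_
    rintro - ⟨z, hz, rfl⟩
    simp only [Finset.mem_coe, Multiset.mem_toFinset, Polynomial.mem_nthRoots hN]
    exact_mod_cast congrArg (fun z : Circle => (z : ℂ)) hz
  by_contra hne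
  refine (hs.image f hf.continuousOn).infinite_of_nontrivial
    ⟨f x, ⟨x, hx, rfl⟩, f y, ⟨y, hy, rfl⟩, hne⟩ (hfin.subset ?_)
  rintro - ⟨z, hz, rfl⟩
  exact hfN z hz

section Main

variable {K : Type*} [Field K] [NumberField K] [IsCMField K] {p : ℕ}
  {ι : K →+* ℂ} {σ : InfinitePlace K → Gal(K/ℚ)}
  (hσ : ∀ v, InfinitePlace.mk (ι.comp (σ v : K →+* K)) = v) {S : Set (Ideal (𝓞 K))}

theorem coe_chi_alpha (μ : InfinitePlace K → ℤ) (x : weilUnits K p) :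
    (chi (fun v => ι.comp (σ v : K →+* K)) hσ μ
      (Multiplicative.ofAdd (alpha K p (Additive.ofMul x))) : ℂ) = ι (galProd σ μ x : Kˣ) := by
  rw [chi_apply, coe_monomial, galProd, Units.coe_prod, map_prod]
  refine Finset.prod_congr rfl fun v _ => ?_
  rw [torusHomeo_alpha, Units.val_zpow_eq_zpow_val, map_zpow₀]
  rfl

theorem chi_alpha_eq_one_iff (μ : InfinitePlace K → ℤ) :
    (∀ x, chi (fun v => ι.comp (σ v : K →+* K)) hσ μ (Multiplicative.ofAdd (alpha K p x)) = 1) ↔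
      ∀ x ∈ weilUnits K p, galProd σ μ x = 1 := by
  have key (x : weilUnits K p) : chi (fun v => ι.comp (σ v : K →+* K)) hσ μ
      (Multiplicative.ofAdd (alpha K p (Additive.ofMul x))) = 1 ↔ galProd σ μ (x : Kˣ) = 1 := by
    rw [Circle.ext_iff, coe_chi_alpha, Circle.coe_one, map_eq_one_iff _ ι.injective,
      Units.val_eq_one]
  exact ⟨fun h x hx => (key ⟨x, hx⟩).mp (h _), fun h x => (key x.toMul).mpr (h _ x.toMul.2)⟩

theorem mem_orthEps_of_chi_alpha_eq_one (hp : p.Prime) (hS : IsRepSystem K p S)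
    {μ : InfinitePlace K → ℤ}
    (hμ : ∀ x, chi (fun v => ι.comp (σ v : K →+* K)) hσ μ
      (Multiplicative.ofAdd (alpha K p x)) = 1) : μ ∈ orthEps σ S := by
  rw [chi_alpha_eq_one_iff] at hμ
  exact fun P hP P' _ => sum_mul_eps_eq_zero_of_galProd_eq_one hp hμ (hS.1 hP)

/-- For `μ` orthogonal to the `ε_{P,P'}`, the character `χ_μ` is torsion on the image of
`E_p(k)`. -/
theorem chi_smul_alpha_eq_one (hp : p.Prime) (hS : IsRepSystem K p S)
    {μ : InfinitePlace K → ℤ} (hμ : μ ∈ orthEps σ S) (x : Additive (weilUnits K p)) :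
    chi (fun v => ι.comp (σ v : K →+* K)) hσ ((Units.torsionOrder K : ℤ) • μ)
      (Multiplicative.ofAdd (alpha K p x)) = 1 := by
  refine (chi_alpha_eq_one_iff hσ _).mpr (fun x hx => ?_) x
  rw [← galProd_pow_torsionOrder_eq_one hp hS hμ hx]
  simp [galProd, zpow_mul, mul_comm _ (μ _), Finset.prod_pow]

/-- The line in direction `a` lies in the closure of the image of `E_p(k)` if and only if `a` is
orthogonal to all `μ` which are orthogonal to the `ε_{P,P'}`. -/
theorem forall_lineMap_mem_iff (hp : p.Prime) (hS : IsRepSystem K p S)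
    (a : InfinitePlace K → ℝ) :
    (∀ t : ℝ, lineMap (fun v => ι.comp (σ v : K →+* K)) hσ (t • a) ∈ imageClosure K p) ↔
      ∀ μ ∈ orthEps σ S, ∑ v, μ v * a v = 0 := by
  constructor
  · intro h μ hμ
    have h1 : ∑ v, (((Units.torsionOrder K : ℤ) • μ) v : ℝ) * a v = 0 := by
      rw [← chi_lineMap_smul_eq_one_iff _ hσ]
      exact fun t => (mem_imageClosure_iff _ hσ p _).mp (h t) _ (chi_smul_alpha_eq_one hσ hp hS hμ)
    simp only [Pi.smul_apply, smul_eq_mul, Int.cast_mul, Int.cast_natCast, mul_assoc,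
      ← Finset.mul_sum] at h1
    exact (mul_eq_zero.mp h1).resolve_left (by exact_mod_cast Units.torsionOrder_ne_zero K)
  · intro h t
    rw [mem_imageClosure_iff _ hσ]
    intro μ hμ
    exact (chi_lineMap_smul_eq_one_iff _ hσ μ a).mpr
      (h μ (mem_orthEps_of_chi_alpha_eq_one hσ hp hS hμ)) t

theorem lineMap_mem_imageClosureZero {a : InfinitePlace K → ℝ}
    (ha : ∀ t : ℝ, lineMap (fun v => ι.comp (σ v : K →+* K)) hσ (t • a) ∈ imageClosure K p)
    (t : ℝ) : lineMap (fun v => ι.comp (σ v : K →+* K)) hσ (t • a) ∈ imageClosureZero K p := by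
  let γ : ℝ → imageClosure K p := fun t => ⟨_, ha t⟩
  have hγ : Continuous γ :=
    ((continuous_lineMap _ hσ).comp (continuous_id.smul continuous_const)).subtype_mk _
  have h0 : γ 0 = 0 := Subtype.ext (by simp [γ])
  refine ⟨γ t, ?_, rfl⟩
  have := (isPreconnected_univ.image γ hγ.continuousOn).subset_connectedComponent
    (x := 0) ⟨0, trivial, h0⟩
  exact this ⟨t, trivial, rfl⟩

/-- The characters trivial on the connected component of zero are the `χ_μ` with `μ` orthogonal to
the `ε_{P,P'}`: such `χ_μ` are torsion on the closure of the image, hence constant on the component,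
and the component contains the lines in the directions `ε_{P,P'}`. -/
theorem chi_eq_one_on_imageClosureZero_iff (hp : p.Prime) (hS : IsRepSystem K p S)
    (μ : InfinitePlace K → ℤ) :
    (∀ t ∈ imageClosureZero K p,
      chi (fun v => ι.comp (σ v : K →+* K)) hσ μ (Multiplicative.ofAdd t) = 1) ↔
      μ ∈ orthEps σ S := by
  constructor
  · intro h P hP P' hP'
    have hline := lineMap_mem_imageClosureZero hσ
      ((forall_lineMap_mem_iff hσ hp hS (fun v => (eps σ P P' v : ℝ))).mpr fun ν hν => by
        exact_mod_cast hν P hP P' hP')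
    have := (chi_lineMap_smul_eq_one_iff _ hσ μ _).mp fun t => h _ (hline t)
    exact_mod_cast this
  · rintro hμ - ⟨t, ht, rfl⟩
    have hc : Continuous fun t : imageClosure K p =>
        chi (fun v => ι.comp (σ v : K →+* K)) hσ μ (Multiplicative.ofAdd (t : Torus K)) :=
      (map_continuous _).comp (continuous_ofAdd.comp continuous_subtype_val)
    have := eq_of_pow_eq_one_of_isPreconnected (x := t) (y := 0)
      (isPreconnected_connectedComponent (x := (0 : imageClosure K p))) hc
      (Units.torsionOrder_pos K) (fun s _ => ?_) ht mem_connectedComponent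
    · refine this.trans ?_
      rw [AddSubgroup.coe_zero, ofAdd_zero, map_one]
    · have h1 := (mem_imageClosure_iff _ hσ p _).mp s.2 _ (chi_smul_alpha_eq_one hσ hp hS hμ)
      rw [← h1, chi_apply, chi_apply, monomial_apply, monomial_apply, ← Finset.prod_pow]
      refine Finset.prod_congr rfl fun v _ => ?_
      rw [Pi.smul_apply, smul_eq_mul, mul_comm, zpow_mul, zpow_natCast]

theorem exists_equiv_pontryaginDual_quotC (hp : p.Prime) (hS : IsRepSystem K p S) :
    ∃ e : Multiplicative (orthEps σ S) ≃ₜ* PontryaginDual (Multiplicative (QuotC K p)),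
      ∀ (μ : orthEps σ S) (t : Torus K),
        e (Multiplicative.ofAdd μ) (Multiplicative.ofAdd (QuotientAddGroup.mk t)) =
          chi (fun v => ι.comp (σ v : K →+* K)) hσ μ (Multiplicative.ofAdd t) := by
  choose ψ hψ using fun μ : orthEps σ S => exists_pontryaginDual_quotient (imageClosureZero K p)
    (chi (fun v => ι.comp (σ v : K →+* K)) hσ μ)
    ((chi_eq_one_on_imageClosureZero_iff hσ hp hS (μ : InfinitePlace K → ℤ)).mpr μ.2)
  have hext {χ₁ χ₂ : PontryaginDual (Multiplicative (QuotC K p))}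
      (h : ∀ t : Torus K, χ₁ (Multiplicative.ofAdd (QuotientAddGroup.mk t)) =
        χ₂ (Multiplicative.ofAdd (QuotientAddGroup.mk t))) : χ₁ = χ₂ := by
    refine PontryaginDual.ext fun t => ?_
    obtain ⟨s, hs⟩ := QuotientAddGroup.mk_surjective t.toAdd
    rw [← ofAdd_toAdd t, ← hs, h]
  have hb := bijective_chi _ hσ
  let f : Multiplicative (orthEps σ S) →* PontryaginDual (Multiplicative (QuotC K p)) :=
    MonoidHom.mk' (fun μ => ψ μ.toAdd) fun μ ν => hext fun t => by
      change ψ _ _ = ψ _ _ * ψ _ _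
      rw [hψ, hψ, hψ, toAdd_mul, AddSubgroup.coe_add, chi_apply, chi_apply, chi_apply, monomial_add]
  have hf : Function.Bijective f := by
    constructor
    · intro μ ν h
      have : (μ.toAdd : InfinitePlace K → ℤ) = ν.toAdd := hb.1 (PontryaginDual.ext fun t => by
        have := DFunLike.congr_fun h (Multiplicative.ofAdd (QuotientAddGroup.mk t.toAdd))
        change ψ _ _ = ψ _ _ at this
        rwa [hψ, hψ] at this)
      exact Subtype.ext this
    · intro χ
      let χ' : PontryaginDual (Multiplicative (Torus K)) := PontryaginDual.map
        (⟨AddMonoidHom.toMultiplicative (QuotientAddGroup.mk' (imageClosureZero K p)),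
          continuous_ofAdd.comp (continuous_quotient_mk'.comp continuous_toAdd)⟩ :
          Multiplicative (Torus K) →ₜ* Multiplicative (QuotC K p)) χ
      have hχ' (t : Torus K) : χ' (Multiplicative.ofAdd t) =
        χ (Multiplicative.ofAdd (QuotientAddGroup.mk t)) := rfl
      obtain ⟨μ, hμ⟩ := hb.2 χ'
      have hμ' : μ ∈ orthEps σ S := by
        rw [← chi_eq_one_on_imageClosureZero_iff hσ hp hS]
        intro t ht
        rw [hμ, hχ', (QuotientAddGroup.eq_zero_iff t).mpr ht, ofAdd_zero, map_one]
      refine ⟨Multiplicative.ofAdd ⟨μ, hμ'⟩, hext fun t => ?_⟩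
      change ψ _ _ = _
      rw [hψ, toAdd_ofAdd, hμ, hχ']
  have := compactSpace_torus _ hσ
  let e := MulEquiv.ofBijective f hf
  exact ⟨{ e with
    continuous_toFun := continuous_of_discreteTopology
    continuous_invFun := continuous_of_discreteTopology }, fun μ t => hψ μ t⟩

theorem mem_orthEps_iff_forall_mem_spanEps (μ : InfinitePlace K → ℤ) :
    μ ∈ orthEps σ S ↔ ∀ w ∈ spanEps σ S, ∑ v, (μ v : ℚ) * w v = 0 := by
  constructor
  · intro hμ w hw
    induction hw using Submodule.span_induction with
    | mem w hw =>
      obtain ⟨P, hP, P', hP', rfl⟩ := hw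
      have := hμ P hP P' hP'
      beta_reduce
      exact_mod_cast this
    | zero => simp
    | add w w' _ _ h h' => simp [mul_add, Finset.sum_add_distrib, h, h']
    | smul c w _ h => simp [mul_left_comm _ c, ← Finset.mul_sum, h]
  · intro h P hP P' hP'
    have := h _ (Submodule.subset_span ⟨P, hP, P', hP', rfl⟩)
    exact_mod_cast this

end Main

section Consequences

variable {K : Type*} [Field K] [NumberField K] {p : ℕ}

/-- Both dimensions are that of the real space `V` of directions of the lines contained in the
closure of the image. -/
theorem lieDim_imageClosure [IsCMField K] {ι : K →+* ℂ} {σ : InfinitePlace K → Gal(K/ℚ)}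
    (hσ : ∀ v, InfinitePlace.mk (ι.comp (σ v : K →+* K)) = v) {S : Set (Ideal (𝓞 K))}
    (hp : p.Prime) (hS : IsRepSystem K p S) :
    lieDim (imageClosure K p) = Module.rank ℚ (spanEps σ S) := by
  let V : Submodule ℝ (InfinitePlace K → ℝ) :=
    { carrier := {a | ∀ μ ∈ orthEps σ S, ∑ v, (μ v : ℝ) * a v = 0}
      zero_mem' := by simp
      add_mem' := fun ha hb μ hμ => by
        simp [mul_add, Finset.sum_add_distrib, ha μ hμ, hb μ hμ]
      smul_mem' := fun c a ha μ hμ => by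
        simp [mul_left_comm _ c, ← Finset.mul_sum, ha μ hμ] }
  have hV (a) : a ∈ V ↔ ∀ μ ∈ orthEps σ S, ∑ v, (μ v : ℝ) * a v = 0 := Iff.rfl
  rw [← rank_eq_rank_of_forall_mem_iff (spanEps σ S) V (fun a => by
    simp_rw [hV, mem_orthEps_iff_forall_mem_spanEps])]
  let φ : InfinitePlace K → (K →+* ℂ) := fun v => ι.comp (σ v : K →+* K)
  have hmem (a : V) (t : ℝ) : lineMap φ hσ (t • (a : InfinitePlace K → ℝ)) ∈ imageClosure K p :=
    (forall_lineMap_mem_iff hσ hp hS _).mpr a.2 t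
  let F : V →ₗ[ℝ] OneParam (imageClosure K p) :=
    { toFun := fun a => (⟨AddMonoidHom.mk' (fun t => ⟨lineMap φ hσ (t • a), hmem a t⟩)
          (fun s t => Subtype.ext (by simp [add_smul])),
          ((continuous_lineMap φ hσ).comp (continuous_id.smul continuous_const)).subtype_mk _⟩ :
          ℝ →ₜ+ imageClosure K p)
      map_add' := fun a b => ContinuousAddMonoidHom.ext fun t => Subtype.ext (by
        change lineMap φ hσ (t • (a + b : InfinitePlace K → ℝ)) = lineMap φ hσ _ + lineMap φ hσ _
        rw [smul_add, map_add])
      map_smul' := fun c a => ContinuousAddMonoidHom.ext fun t => Subtype.ext (by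
        change lineMap φ hσ (t • c • (a : InfinitePlace K → ℝ)) = lineMap φ hσ ((c * t) • _)
        rw [smul_smul, mul_comm]) }
  have hF (a : V) (t : ℝ) :
      (((show ℝ →ₜ+ imageClosure K p from F a) t : imageClosure K p) : Torus K) =
        lineMap φ hσ (t • (a : InfinitePlace K → ℝ)) := rfl
  refine (LinearEquiv.rank_eq (LinearEquiv.ofBijective F ⟨?_, ?_⟩)).symm
  · intro a b hab
    refine Subtype.ext (funext fun v => eq_of_circle_exp_mul fun t => ?_)
    have h1 : lineMap φ hσ (t • (a : InfinitePlace K → ℝ)) =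
        lineMap φ hσ (t • (b : InfinitePlace K → ℝ)) := by rw [← hF, ← hF, hab]
    have h2 := congrFun (congrArg (torusHomeo φ hσ) h1) v
    rwa [torusHomeo_lineMap, torusHomeo_lineMap] at h2
  · intro γ
    let γ' : ℝ →ₜ+ imageClosure K p := γ
    obtain ⟨a, ha⟩ := exists_eq_lineMap φ hσ (fun t => (γ' t : Torus K))
      (continuous_subtype_val.comp γ'.continuous_toFun)
      (fun s t => by rw [map_add, AddSubgroup.coe_add])
    refine ⟨⟨a, (forall_lineMap_mem_iff hσ hp hS a).mp fun t => ?_⟩, ?_⟩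
    · rw [← ha]
      exact (γ' t).2
    · exact ContinuousAddMonoidHom.ext fun t => Subtype.ext (ha t).symm

/-- The Galois group acts transitively on the primes over `p`, and freely if there are as many of
them as group elements. -/
theorem smul_left_injective_of_splitsCompletely [IsGalois ℚ K] (hp : p.Prime)
    (h : SplitsCompletely K p) {P : Ideal (𝓞 K)}
    (hP : P ∈ (Ideal.span {(p : ℤ)}).primesOver (𝓞 K)) :
    Function.Injective fun g : Gal(K/ℚ) => g • P := by
  have := isMaximal_span_of_prime hp
  have hmem (g : Gal(K/ℚ)) : g • P ∈ (Ideal.span {(p : ℤ)}).primesOver (𝓞 K) := by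
    have := hP.1
    have := hP.2
    exact (Ideal.primesOver.mk (Ideal.span {(p : ℤ)}) (g • P)).2
  let f : Gal(K/ℚ) → (Ideal.span {(p : ℤ)}).primesOver (𝓞 K) := fun g => ⟨g • P, hmem g⟩
  have hf : Function.Surjective f := by
    rintro ⟨Q, hQ⟩
    have := hP.1
    have := hP.2
    have := hQ.1
    have := hQ.2
    obtain ⟨g, hg⟩ := Ideal.exists_smul_eq_of_isGaloisGroup (Ideal.span {(p : ℤ)}) P Q Gal(K/ℚ)
    exact ⟨g, Subtype.ext hg⟩
  have hcard : Nat.card Gal(K/ℚ) = Nat.card ((Ideal.span {(p : ℤ)}).primesOver (𝓞 K)) := by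
    rw [IsGalois.card_aut_eq_finrank, Nat.card_coe_set_eq]
    exact h.symm
  have hinj := ((Nat.bijective_iff_surjective_and_card f).mpr ⟨hf, hcard⟩).1
  exact fun g g' hg => hinj (Subtype.ext hg)

/-- For `P ∈ S` and a place `v`, let `P' ∈ S` represent the class of `σ_v P`. As the group acts
freely on the primes, `ε_{P,P'}` is nonzero only at `v`, so orthogonality to it gives `μ_v = 0`. -/
theorem orthEps_eq_bot_of_splitsCompletely [IsCMField K] [IsGalois ℚ K] {ι : K →+* ℂ}
    {σ : InfinitePlace K → Gal(K/ℚ)} (hσ : ∀ v, InfinitePlace.mk (ι.comp (σ v : K →+* K)) = v)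
    {S : Set (Ideal (𝓞 K))} (hp : p.Prime) (hS : IsRepSystem K p S)
    (h : SplitsCompletely K p) : orthEps σ S = ⊥ := by
  have hfree {P : Ideal (𝓞 K)} (hP : P ∈ (Ideal.span {(p : ℤ)}).primesOver (𝓞 K)) :
      P ∈ primesT K p := by
    refine ⟨hP, fun hc => conj_ne_one (K := K) ?_⟩
    exact smul_left_injective_of_splitsCompletely hp h hP (by simpa using hc)
  have hmax := isMaximal_span_of_prime hp
  obtain ⟨P₀, hP₀⟩ := Ideal.nonempty_primesOver (S := 𝓞 K) (Ideal.span {(p : ℤ)})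
  obtain ⟨P, ⟨hP, -⟩, -⟩ := hS.2 P₀ (hfree hP₀)
  have hinj := smul_left_injective_of_splitsCompletely hp h (hS.1 hP).1
  have hinjσ {v w : InfinitePlace K} (h : σ w = σ v ∨ σ w = conj K * σ v) : w = v := by
    rw [← hσ w, ← hσ v]
    rcases h with h | h
    · rw [h]
    · rw [h, InfinitePlace.mk_eq_iff]
      right
      ext x
      simp [ComplexEmbedding.conjugate_coe_eq, embedding_conj]
  rw [eq_bot_iff]
  intro μ hμ
  rw [AddSubgroup.mem_bot]
  funext v
  obtain ⟨P', ⟨hP', hP'v⟩, -⟩ := hS.2 _ (smul_mem_primesT hp (σ v) (hS.1 hP))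
  have h1 : eps σ P P' v ≠ 0 := by
    unfold eps
    rcases hP'v with rfl | rfl
    · simp
    · rw [conj_smul_conj_smul, if_pos rfl]
      split_ifs <;> simp
  have h2 (w : InfinitePlace K) (hw : w ≠ v) : eps σ P P' w = 0 := by
    have h3 : σ w • P ≠ σ v • P := fun h => hw (hinjσ (Or.inl (hinj h)))
    have h4 : σ w • P ≠ conj K • σ v • P := fun h =>
      hw (hinjσ (Or.inr (hinj (h.trans (smul_smul _ _ _)))))
    unfold eps
    rcases hP'v with rfl | rfl
    · rw [if_neg h3, if_neg h4]
    · rw [conj_smul_conj_smul, if_neg h4, if_neg h3]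
  have := hμ P hP P' hP'
  rw [Finset.sum_eq_single v (fun w _ hw => by rw [h2 w hw, mul_zero]) (by simp)] at this
  exact (mul_eq_zero.mp this).resolve_right h1

theorem denseRange_alpha_of_splitsCompletely [IsCMField K] [IsGalois ℚ K] {ι : K →+* ℂ}
    {σ : InfinitePlace K → Gal(K/ℚ)} (hσ : ∀ v, InfinitePlace.mk (ι.comp (σ v : K →+* K)) = v)
    {S : Set (Ideal (𝓞 K))} (hp : p.Prime)
    (hS : IsRepSystem K p S) (h : SplitsCompletely K p) : DenseRange (alpha K p) := by
  intro t
  change t ∈ imageClosure K p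
  rw [mem_imageClosure_iff _ hσ]
  intro μ hμ
  have := mem_orthEps_of_chi_alpha_eq_one hσ hp hS hμ
  rw [orthEps_eq_bot_of_splitsCompletely hσ hp hS h, AddSubgroup.mem_bot] at this
  rw [this, chi_apply, monomial_zero]

end Consequences

end PWeil

end

theorem theorem4p1 (K : Type*) [Field K] [NumberField K] [NumberField.IsCMField K] [IsGalois ℚ K]
    (p : ℕ) (hp : p.Prime)
    -- a fixed embedding `k ⊆ ℂ`, and for every infinite place `v` some `σ_v ∈ G` inducing it
    (ι : K →+* ℂ) (σ : NumberField.InfinitePlace K → Gal(K/ℚ))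
    (hσ : ∀ v, NumberField.InfinitePlace.mk (ι.comp (σ v : K →+* K)) = v)
    (S : Set (Ideal (NumberField.RingOfIntegers K))) (hS : PWeil.IsRepSystem K p S) :
    -- `μ ↦ χ_μ` identifies `⨁_{v ∣ ∞} ℤ` with the Pontryagin dual of `T_k`
    Function.Bijective (PWeil.chi (fun v => ι.comp (σ v : K →+* K)) hσ) ∧
    -- under it the Pontryagin dual of `C` is the set of all `μ` orthogonal to the `ε_{P,P'}`
    (∃ e : Multiplicative (PWeil.orthEps σ S) ≃ₜ*
        PontryaginDual (Multiplicative (PWeil.QuotC K p)),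
      ∀ (μ : PWeil.orthEps σ S) (t : PWeil.Torus K),
        e (Multiplicative.ofAdd μ) (Multiplicative.ofAdd (QuotientAddGroup.mk t)) =
          PWeil.chi (fun v => ι.comp (σ v : K →+* K)) hσ μ (Multiplicative.ofAdd t)) ∧
    PWeil.lieDim (PWeil.imageClosure K p) = Module.rank ℚ (PWeil.spanEps σ S) ∧
    (PWeil.SplitsCompletely K p → DenseRange (PWeil.alpha K p)) :=
  ⟨PWeil.bijective_chi _ hσ, PWeil.exists_equiv_pontryaginDual_quotC hσ hp hS,
    PWeil.lieDim_imageClosure hσ hp hS, PWeil.denseRange_alpha_of_splitsCompletely hσ hp hS⟩
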